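/- Let $d\ge 2$ be an integer and $0<s<\frac d2$. For $\varphi\in C_c^\infty(\mathbb R^d)$ let $(-\Delta)^s\varphi=\mathscr F^{-1}\big[|\cdot|^{2s}\mathscr F[\varphi]\big]$, where $\mathscr F$ is the Fourier transform $\mathscr F[\varphi](\xi)=\int_{\mathbb R^d}e^{-ix\cdot\xi}\varphi(x)\,dx$, and write $B_r=\{x\in\mathbb R^d:|x|<r\}$. Then for every multi-index $n\in\mathbb N^d$ there is a constant $C=C(d,s,n)>0$ such that the following holds for all $R>0$. Let $k\in\mathbb N$, $p_1,\dots,p_k\in[1,\infty)$, $u_i\in L^{p_i}(\mathbb R^d)$ real-valued and $u=\sum_{i=1}^k u_i$ a.e. Suppose that $u$ is $s$-harmonic in $B_{2R}$, that is, $(-\Delta)^s u=0$ in $\mathscr D'(B_{2R})$: $$\int_{\mathbb R^d}u(x)\,(-\Delta)^s\varphi(x)\,dx=0\qquad\text{for all }\varphi\in C_c^\infty(B_{2R}).$$ Then $u\in C^\infty(\overline{B_R})$, i.e. $u$ coincides a.e. on $\overline{B_R}$ with the restriction of a $C^\infty$ function on $\mathbb R^d$, and, with $D^nu$ computed from this smooth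 representative, for every multi-index $n\in\mathbb N^d$ $$\|D^n u\|_{L^\infty(\overline{B_R})}\le C(d,s,n)\sum_{i=1}^k R^{-|n|-\frac d{p_i}}\,\|u_i\|_{L^{p_i}(\mathbb R^d)}.$$ -/

import Mathlib

open MeasureTheory
open scoped FourierTransform ContDiff

noncomputable section

/-- The fractional Laplacian `(-Δ)^s φ = 𝓕⁻¹[|ξ|^{2s} 𝓕 φ]` of a test function `φ` on `ℝ^d`.
Mathlib's Fourier transform has kernel `exp (-2π i ⟪x, ξ⟫)`, so the symbol `|ξ|^{2s}` of the
normalization with kernel `exp (-i ⟪x, ξ⟫)` becomes `(2π|ξ|)^{2s}`. The value is a complex number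
that happens to be real, since `φ` is real and the symbol is real and even. -/
def fracLaplacian {d : ℕ} (s : ℝ) (φ : EuclideanSpace ℝ (Fin d) → ℝ) :
    EuclideanSpace ℝ (Fin d) → ℂ :=
  𝓕⁻ (fun ξ : EuclideanSpace ℝ (Fin d) =>
    (((2 * Real.pi * ‖ξ‖) ^ (2 * s) : ℝ) : ℂ) *
      𝓕 (fun x : EuclideanSpace ℝ (Fin d) => (φ x : ℂ)) ξ)

/-- `(-Δ)^s u = 0` in `𝒟'(Ω)`: the distribution `φ ↦ ∫ u (-Δ)^s φ` vanishes on all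
`φ ∈ C_c^∞(Ω)`. Meaningful for every locally integrable `u` with
`∫ |u(x)| / (1 + |x|)^{d+2s} dx < ∞`, in particular for finite sums of `L^p` functions, because
`(-Δ)^s φ` is continuous and `O((1 + |x|)^{-d-2s})`, so that the integrand is then integrable. -/
def IsFracHarmonicOn {d : ℕ} (s : ℝ) (u : EuclideanSpace ℝ (Fin d) → ℝ)
    (Ω : Set (EuclideanSpace ℝ (Fin d))) : Prop :=
  ∀ φ : EuclideanSpace ℝ (Fin d) → ℝ, ContDiff ℝ ∞ φ → HasCompactSupport φ → tsupport φ ⊆ Ω →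
    ∫ x, (u x : ℂ) * fracLaplacian s φ x = 0

/-- The partial derivative `∂_i f`. -/
def partialDeriv {d : ℕ} (i : Fin d) (f : EuclideanSpace ℝ (Fin d) → ℝ) :
    EuclideanSpace ℝ (Fin d) → ℝ :=
  fun x => fderiv ℝ f x (EuclideanSpace.single i 1)

/-- The partial derivative `D^n f = ∂_0^{n_0} ∂_1^{n_1} ⋯ ∂_{d-1}^{n_{d-1}} f` for a multi-index
`n ∈ ℕ^d`. -/
def multiDeriv {d : ℕ} (n : Fin d → ℕ) (f : EuclideanSpace ℝ (Fin d) → ℝ) :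
    EuclideanSpace ℝ (Fin d) → ℝ :=
  (List.finRange d).foldr (fun i g => (partialDeriv i)^[n i] g) f

end

/-! Let `Λ` be the hypersingular integral, a multiple of `(-Δ)^s`, let `η` be a radial test function
supported in the unit ball, and put `ρ x = ∫₀¹ λ^{d-1} (Λ η)(λ x) dλ`, so that
`d/dt [t^d ρ(t x)] = t^{d-1} (Λ η)(t x)`. Since `y ↦ η(t (x - y))` is a test function supported in
the ball of radius `1/t` around `x`, an `s`-harmonic `u` is orthogonal to `(Λ η)(t (x - ·))` for
large `t`, so the convolution of `u` with `t^d ρ(t ·)` does not depend on `t` there. As `t → ∞` it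
tends to `(∫ ρ) u`, whereas for `t = 2/R` it is smooth and its derivatives are controlled by
Hölder's inequality and scaling. As `Λ η` is radial with mean zero, `ρ` equals
`-∫₁^∞ λ^{d-1} (Λ η)(λ x) dλ` away from the origin and hence decays integrably. Finally `∫ ρ > 0`,
because the Fourier transform of `Λ η` is nonnegative as soon as that of `η` is, and this holds for
an autocorrelation `η`. -/

open Filter Topology Module Metric Set Bornology

noncomputable section

section ParametricIntegral

variable {E F α : Type*} [NormedAddCommGroup E] [NormedSpace ℝ E] [NormedAddCommGroup F]
  [NormedSpace ℝ F] [MeasurableSpace α] {μ : Measure α}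

lemma integral_curryLeft {n : ℕ} (f : α → E [×(n + 1)]→L[ℝ] F) :
    ∫ a, (f a).curryLeft ∂μ = (∫ a, f a ∂μ).curryLeft :=
  ContinuousLinearEquiv.integral_comp_comm (𝕜 := ℝ) (E := E [×(n + 1)]→L[ℝ] F)
    (F := E →L[ℝ] E [×n]→L[ℝ] F)
    (continuousMultilinearCurryLeftEquiv ℝ (fun _ : Fin (n + 1) => E) F).toContinuousLinearEquiv f

lemma integral_curry0 (f : α → E [×0]→L[ℝ] F) :
    ∫ a, (f a).curry0 ∂μ = (∫ a, f a ∂μ).curry0 :=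
  ContinuousLinearEquiv.integral_comp_comm (𝕜 := ℝ) (E := E [×0]→L[ℝ] F)
    (continuousMultilinearCurryFin0 ℝ E F).toContinuousLinearEquiv f

/-- The hypothesis for differentiating `x ↦ ∫ G a x dμ(a)` under the integral sign infinitely
often: every `G a` is smooth, and each of its iterated derivatives is dominated, near every point,
by an integrable function of `a`. -/
structure SmoothDominated (μ : Measure α) (G : α → E → F) : Prop where
  contDiff (a : α) : ContDiff ℝ ∞ (G a)
  aestronglyMeasurable (n : ℕ) (x : E) :
    AEStronglyMeasurable (fun a => iteratedFDeriv ℝ n (G a) x) μ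
  exists_bound (n : ℕ) (x : E) : ∃ s ∈ 𝓝 x, ∃ bound : α → ℝ, Integrable bound μ ∧
    ∀ᵐ a ∂μ, ∀ z ∈ s, ‖iteratedFDeriv ℝ n (G a) z‖ ≤ bound a

namespace SmoothDominated

variable {G : α → E → F}

lemma integrable_iteratedFDeriv (hG : SmoothDominated μ G) (n : ℕ) (x : E) :
    Integrable (fun a => iteratedFDeriv ℝ n (G a) x) μ := by
  obtain ⟨s, hs, bound, hbound, h⟩ := hG.exists_bound n x
  exact hbound.mono' (hG.aestronglyMeasurable n x) (h.mono fun a ha => ha x (mem_of_mem_nhds hs))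

lemma hasFDerivAt_integral_iteratedFDeriv (hG : SmoothDominated μ G) (n : ℕ) (x : E) :
    HasFDerivAt (fun x => ∫ a, iteratedFDeriv ℝ n (G a) x ∂μ)
      (∫ a, iteratedFDeriv ℝ (n + 1) (G a) x ∂μ).curryLeft x := by
  obtain ⟨s, hs, bound, hbound, h⟩ := hG.exists_bound (n + 1) x
  have h_diff (a : α) (z : E) : HasFDerivAt (iteratedFDeriv ℝ n (G a))
      (iteratedFDeriv ℝ (n + 1) (G a) z).curryLeft z :=
    (contDiff_iff_ftaylorSeries.1 (hG.contDiff a)).fderiv n (mod_cast ENat.natCast_lt_top n) z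
  rw [← integral_curryLeft]
  refine hasFDerivAt_integral_of_dominated_of_fderiv_le hs
    (Eventually.of_forall (hG.aestronglyMeasurable n)) (hG.integrable_iteratedFDeriv n x)
    ((continuousMultilinearCurryLeftEquiv ℝ _ F).continuous.comp_aestronglyMeasurable
      (hG.aestronglyMeasurable (n + 1) x)) ?_ hbound
    (Eventually.of_forall fun a z _ => h_diff a z)
  filter_upwards [h] with a ha z hz
  exact (ContinuousMultilinearMap.curryLeft_norm _).trans_le (ha z hz)

lemma hasFTaylorSeriesUpTo_integral (hG : SmoothDominated μ G) :
    HasFTaylorSeriesUpTo ∞ (fun x => ∫ a, G a x ∂μ)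
      fun x n => ∫ a, iteratedFDeriv ℝ n (G a) x ∂μ := by
  refine (hasFTaylorSeriesUpTo_top_iff' le_rfl).2
    ⟨fun x => ?_, hG.hasFDerivAt_integral_iteratedFDeriv⟩
  rw [← integral_curry0]
  rfl

lemma contDiff_integral (hG : SmoothDominated μ G) : ContDiff ℝ ∞ fun x => ∫ a, G a x ∂μ :=
  hG.hasFTaylorSeriesUpTo_integral.contDiff

lemma iteratedFDeriv_integral (hG : SmoothDominated μ G) (n : ℕ) :
    iteratedFDeriv ℝ n (fun x => ∫ a, G a x ∂μ) = fun x => ∫ a, iteratedFDeriv ℝ n (G a) x ∂μ :=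
  funext fun x => (hG.hasFTaylorSeriesUpTo_integral.eq_iteratedFDeriv (mod_cast le_top) x).symm

end SmoothDominated

end ParametricIntegral

section PolynomialWeight

variable {E : Type*} [NormedAddCommGroup E] {r : ℝ}

/-- The weight `(1 + ‖x‖)^{-r}`, which measures polynomial decay of order `r` without a singularity
at the origin. Decay at this rate is expressed by `f =O[⊤] polyWeight r`. -/
def polyWeight (r : ℝ) (x : E) : ℝ := (1 + ‖x‖) ^ (-r)

lemma polyWeight_pos (x : E) : 0 < polyWeight r x := Real.rpow_pos_of_pos (by positivity) _

lemma norm_polyWeight (x : E) : ‖polyWeight r x‖ = polyWeight r x :=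
  Real.norm_of_nonneg (polyWeight_pos x).le

@[fun_prop]
lemma continuous_polyWeight : Continuous (polyWeight r : E → ℝ) :=
  (continuous_const.add continuous_norm).rpow_const fun x =>
    Or.inl (by positivity : 0 < 1 + ‖x‖).ne'

lemma polyWeight_le_one (hr : 0 ≤ r) (x : E) : polyWeight r x ≤ 1 :=
  Real.rpow_le_one_of_one_le_of_nonpos (by linarith [norm_nonneg x]) (by linarith)

lemma polyWeight_le_polyWeight {q : ℝ} (hqr : q ≤ r) (x : E) : polyWeight r x ≤ polyWeight q x :=
  Real.rpow_le_rpow_of_exponent_le (by linarith [norm_nonneg x]) (by linarith)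

lemma polyWeight_neg (x : E) : polyWeight (-r) x = (1 + ‖x‖) ^ r := by rw [polyWeight, neg_neg]

lemma polyWeight_neg_mul (x : E) : polyWeight (-r) x * polyWeight r x = 1 := by
  rw [polyWeight, polyWeight, ← Real.rpow_add (by positivity), neg_neg, add_neg_cancel,
    Real.rpow_zero]

lemma polyWeight_le_of_le_mul {b : ℝ} (hr : 0 ≤ r) (hb : 0 < b) {x y : E}
    (h : 1 + ‖y‖ ≤ b * (1 + ‖x‖)) : polyWeight r x ≤ b ^ r * polyWeight r y := by
  calc polyWeight r x = b ^ r * (b * (1 + ‖x‖)) ^ (-r) := by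
        rw [Real.mul_rpow hb.le (by positivity), ← mul_assoc, ← Real.rpow_add hb, add_neg_cancel,
          Real.rpow_zero, one_mul, polyWeight]
    _ ≤ b ^ r * polyWeight r y := by
        gcongr
        exact Real.rpow_le_rpow_of_nonpos (by positivity) h (by linarith)

lemma polyWeight_sub_le (hr : 0 ≤ r) (x y : E) :
    polyWeight r (x - y) ≤ (1 + ‖x‖) ^ r * polyWeight r y := by
  refine polyWeight_le_of_le_mul hr (by positivity) ?_
  have h : ‖y‖ ≤ ‖x‖ + ‖x - y‖ := by simpa using norm_sub_le x (x - y)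
  nlinarith [norm_nonneg x, norm_nonneg (x - y)]

lemma polyWeight_smul_le [NormedSpace ℝ E] {b t : ℝ} (hr : 0 ≤ r) (hb : 0 < b) (hb1 : b ≤ 1)
    (hbt : b ≤ t) (x : E) : polyWeight r (t • x) ≤ b⁻¹ ^ r * polyWeight r x := by
  refine polyWeight_le_of_le_mul hr (inv_pos.2 hb) ?_
  rw [inv_mul_eq_div, le_div_iff₀ hb, norm_smul, Real.norm_of_nonneg (hb.le.trans hbt)]
  nlinarith [norm_nonneg x]

lemma isBigO_top_polyWeight_iff {F : Type*} [Norm F] {f : E → F} :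
    f =O[⊤] (polyWeight r : E → ℝ) ↔ ∃ C > 0, ∀ x, ‖f x‖ ≤ C * polyWeight r x := by
  simp only [Asymptotics.isBigO_iff', eventually_top, norm_polyWeight]

lemma isBigO_polyWeight_cobounded (hr : 0 ≤ r) :
    (fun x : E => ‖x‖ ^ (-r)) =O[cobounded E] (polyWeight r : E → ℝ) := by
  refine Asymptotics.IsBigO.of_bound (2 ^ r) ?_
  filter_upwards [eventually_cobounded_le_norm (1 : ℝ)] with x hx
  have hx0 : 0 < ‖x‖ := by linarith
  calc ‖‖x‖ ^ (-r)‖ = 2 ^ r * (2 * ‖x‖) ^ (-r) := by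
        rw [Real.norm_of_nonneg (by positivity), Real.mul_rpow two_pos.le hx0.le, ← mul_assoc,
          ← Real.rpow_add two_pos, add_neg_cancel, Real.rpow_zero, one_mul]
    _ ≤ 2 ^ r * ‖polyWeight r x‖ := by
        rw [norm_polyWeight]
        gcongr
        exact Real.rpow_le_rpow_of_nonpos (by positivity) (by linarith) (by linarith)

lemma isBigO_top_polyWeight_of_cobounded [ProperSpace E] {F : Type*} [NormedAddCommGroup F]
    {f : E → F} (hr : 0 ≤ r) (hf : Continuous f)
    (h : f =O[cobounded E] fun x => ‖x‖ ^ (-r)) : f =O[⊤] (polyWeight r : E → ℝ) := by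
  obtain ⟨C, hC⟩ := (h.trans (isBigO_polyWeight_cobounded hr)).bound
  obtain ⟨X, hX⟩ := hasBasis_cobounded_norm.eventually_iff.1 hC
  have h_ratio : Continuous fun x => ‖f x‖ / polyWeight r x :=
    hf.norm.div continuous_polyWeight fun x => (polyWeight_pos x).ne'
  obtain ⟨M, hM⟩ := (isCompact_closedBall (0 : E) X).exists_bound_of_continuousOn
    h_ratio.continuousOn
  refine Asymptotics.isBigO_top.2 ⟨max C M, fun x => ?_⟩
  rw [norm_polyWeight]
  rcases le_total X ‖x‖ with hx | hx
  · refine (hX.2 hx).trans ?_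
    rw [norm_polyWeight]
    gcongr
    exacts [(polyWeight_pos x).le, le_max_left _ _]
  · rw [← div_le_iff₀ (polyWeight_pos x)]
    exact (le_abs_self _).trans ((hM x (by simpa using hx)).trans (le_max_right _ _))

end PolynomialWeight

section SmoothDecay

variable {E F : Type*} [NormedAddCommGroup E] [NormedSpace ℝ E] [NormedAddCommGroup F]
  [NormedSpace ℝ F] {r : ℝ} {f : E → F}

lemma iteratedFDeriv_const_smul_comp_smul {n : ℕ} (hf : ContDiff ℝ n f) (c t : ℝ) :
    iteratedFDeriv ℝ n (fun x => c • f (t • x)) =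
      fun x => (c * t ^ n) • iteratedFDeriv ℝ n f (t • x) := by
  ext1 x
  rw [iteratedFDeriv_const_smul_apply' (f := fun x => f (t • x))
      (hf.comp (contDiff_const_smul t)).contDiffAt,
    iteratedFDeriv_comp_const_smul t hf, smul_smul]

/-- A smooth function all of whose derivatives are `O((1 + ‖x‖)^{-r})`. -/
structure SmoothDecay (r : ℝ) (f : E → F) : Prop where
  contDiff : ContDiff ℝ ∞ f
  isBigO_iteratedFDeriv (n : ℕ) : iteratedFDeriv ℝ n f =O[⊤] (polyWeight r : E → ℝ)

namespace SmoothDecay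

lemma isBigO (hf : SmoothDecay r f) : f =O[⊤] (polyWeight r : E → ℝ) :=
  (Asymptotics.isBigO_of_le ⊤ fun x => by rw [norm_iteratedFDeriv_zero]).trans
    (hf.isBigO_iteratedFDeriv 0)

lemma mono {q : ℝ} (hf : SmoothDecay r f) (hqr : q ≤ r) : SmoothDecay q f where
  contDiff := hf.contDiff
  isBigO_iteratedFDeriv n := (hf.isBigO_iteratedFDeriv n).trans <| Asymptotics.isBigO_of_le ⊤
    fun x => by simpa only [norm_polyWeight] using polyWeight_le_polyWeight hqr x

lemma const_smul_comp_smul (hf : SmoothDecay r f) (hr : 0 ≤ r) (c : ℝ) {t : ℝ} (ht : 0 < t) :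
    SmoothDecay r fun x => c • f (t • x) where
  contDiff := contDiff_const.smul (hf.contDiff.comp (contDiff_const_smul t))
  isBigO_iteratedFDeriv n := by
    obtain ⟨C, hC, h⟩ := isBigO_top_polyWeight_iff.1 (hf.isBigO_iteratedFDeriv n)
    refine Asymptotics.isBigO_top.2 ⟨|c * t ^ n| * (C * (min 1 t)⁻¹ ^ r), fun x => ?_⟩
    rw [iteratedFDeriv_const_smul_comp_smul (contDiff_infty.1 hf.contDiff n), norm_smul,
      Real.norm_eq_abs, norm_polyWeight, mul_assoc, mul_assoc]
    gcongr
    refine (h _).trans ?_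
    gcongr
    exact polyWeight_smul_le hr (lt_min one_pos ht) (min_le_left _ _) (min_le_right _ _) x

end SmoothDecay

end SmoothDecay

section WeightIntegrable

variable {E F : Type*} [NormedAddCommGroup E] [MeasureSpace E] {r : ℝ} {u v : E → ℝ}

/-- `u` is integrable against the weight `(1 + ‖x‖)^{-r}`. -/
def WeightIntegrable (r : ℝ) (u : E → ℝ) : Prop := Integrable fun x => polyWeight r x * u x

lemma WeightIntegrable.congr (hu : WeightIntegrable r u) (h : v =ᵐ[volume] u) :
    WeightIntegrable r v :=
  Integrable.congr hu (h.mono fun x hx => by simp only [hx])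

lemma WeightIntegrable.sum {ι : Type*} {s : Finset ι} {w : ι → E → ℝ}
    (hw : ∀ i ∈ s, WeightIntegrable r (w i)) : WeightIntegrable r fun x => ∑ i ∈ s, w i x := by
  simp only [WeightIntegrable, Finset.mul_sum]
  exact integrable_finsetSum s hw

variable [BorelSpace E]

lemma WeightIntegrable.aestronglyMeasurable (hu : WeightIntegrable r u) :
    AEStronglyMeasurable u := by
  have h := (continuous_polyWeight (E := E) (r := -r)).aestronglyMeasurable.mul
    (Integrable.aestronglyMeasurable hu)
  refine h.congr (Eventually.of_forall fun x => ?_)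
  simp only [Pi.mul_apply]
  rw [← mul_assoc, polyWeight_neg_mul, one_mul]

lemma WeightIntegrable.locallyIntegrable [ProperSpace E] (hu : WeightIntegrable r u) :
    LocallyIntegrable u := by
  have h := ((Integrable.locallyIntegrable hu).locallyIntegrableOn univ).continuousOn_mul
    (continuous_polyWeight (r := -r)).continuousOn isClosed_univ.isLocallyClosed
  refine (locallyIntegrableOn_univ.1 h).congr (Eventually.of_forall fun x => ?_)
  simp only
  rw [← mul_assoc, polyWeight_neg_mul, one_mul]

lemma WeightIntegrable.integrable_smul [NormedAddCommGroup F] [NormedSpace ℝ F]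
    (hu : WeightIntegrable r u) {K : E → F} (hK : AEStronglyMeasurable K)
    (hKr : K =O[⊤] (polyWeight r : E → ℝ)) : Integrable fun x => u x • K x := by
  obtain ⟨C, -, hC⟩ := isBigO_top_polyWeight_iff.1 hKr
  refine (hu.norm.const_mul C).mono' (hu.aestronglyMeasurable.smul hK) ?_
  filter_upwards with x
  rw [norm_smul, norm_mul, norm_polyWeight]
  nlinarith [mul_le_mul_of_nonneg_left (hC x) (norm_nonneg (u x))]

end WeightIntegrable

section Holder

lemma eLpNorm_le_rpow_eLpNorm_one {α F : Type*} [MeasurableSpace α] {μ : Measure α}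
    [NormedAddCommGroup F] {f : α → F} (hf : ∀ᵐ a ∂μ, ‖f a‖ ≤ 1) {q : ENNReal} (hq : 1 ≤ q) :
    eLpNorm f q μ ≤ eLpNorm f 1 μ ^ q⁻¹.toReal := by
  have hf' : ∀ᵐ a ∂μ, ‖f a‖ₑ ≤ 1 := hf.mono fun a ha => by
    rw [← ofReal_norm]
    exact ENNReal.ofReal_le_one.2 ha
  rcases eq_or_ne q ⊤ with rfl | hq_top
  · simpa using eLpNormEssSup_le_of_ae_enorm_bound hf'
  have hq1 : 1 ≤ q.toReal := by simpa using ENNReal.toReal_mono hq_top hq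
  rw [eLpNorm_eq_lintegral_rpow_enorm_toReal (one_pos.trans_le hq).ne' hq_top,
    eLpNorm_one_eq_lintegral_enorm, ENNReal.toReal_inv, one_div]
  refine ENNReal.rpow_le_rpow (lintegral_mono_ae (hf'.mono fun a ha => ?_)) (by positivity)
  simpa using ENNReal.rpow_le_rpow_of_exponent_ge ha hq1

variable {E : Type*} [NormedAddCommGroup E] [NormedSpace ℝ E] [FiniteDimensional ℝ E]
  [MeasureSpace E] [BorelSpace E] [(volume : Measure E).IsAddHaarMeasure] {r : ℝ} {p : ENNReal}
  {u : E → ℝ}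

lemma integrable_polyWeight (hr : finrank ℝ E < r) : Integrable (polyWeight r : E → ℝ) :=
  integrable_one_add_norm hr

lemma SmoothDecay.integrable {F : Type*} [NormedAddCommGroup F] [NormedSpace ℝ F] {f : E → F}
    (hr : finrank ℝ E < r) (hf : SmoothDecay r f) : Integrable f :=
  have ⟨C, _, h_bound⟩ := isBigO_top_polyWeight_iff.1 hf.isBigO
  ((integrable_polyWeight hr).const_mul C).mono' hf.contDiff.continuous.aestronglyMeasurable
    (Eventually.of_forall h_bound)

lemma memLp_polyWeight (hr : finrank ℝ E < r) (hp : 1 ≤ p) :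
    MemLp (polyWeight r : E → ℝ) p := by
  have hr0 : 0 ≤ r := (Nat.cast_nonneg _).trans hr.le
  have h_one : eLpNorm (polyWeight r : E → ℝ) 1 ≠ ⊤ :=
    (memLp_one_iff_integrable.2 (integrable_polyWeight hr)).eLpNorm_ne_top
  refine ⟨continuous_polyWeight.aestronglyMeasurable, (eLpNorm_le_rpow_eLpNorm_one ?_ hp).trans_lt
    (ENNReal.rpow_lt_top_of_nonneg ENNReal.toReal_nonneg h_one)⟩
  exact Eventually.of_forall fun x => (norm_polyWeight x).trans_le (polyWeight_le_one hr0 x)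

lemma WeightIntegrable.of_memLp (hr : finrank ℝ E < r) (hp : 1 ≤ p) (hu : MemLp u p) :
    WeightIntegrable r u := by
  have : p.HolderConjugate p.conjExponent := .conjExponent hp
  have : p.conjExponent.HolderConjugate p := .symm
  have hW : MemLp (polyWeight r : E → ℝ) p.conjExponent := memLp_polyWeight hr le_self_add
  exact hW.integrable_mul hu

lemma eLpNorm_polyWeight_smul_sub_le (hr : finrank ℝ E < r) (hp : 1 ≤ p) {t : ℝ} (ht : 0 < t)
    (x : E) : eLpNorm (fun y => polyWeight r (t • (x - y))) p ≤
      ENNReal.ofReal (((t ^ finrank ℝ E)⁻¹ * ∫ y : E, polyWeight r y) ^ p⁻¹.toReal) := by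
  have hr0 : 0 ≤ r := (Nat.cast_nonneg _).trans hr.le
  have h_int : Integrable fun y : E => polyWeight r (t • (x - y)) :=
    ((integrable_polyWeight hr).comp_smul ht.ne').comp_sub_left x
  have h_one : eLpNorm (fun y => polyWeight r (t • (x - y))) 1 =
      ENNReal.ofReal ((t ^ finrank ℝ E)⁻¹ * ∫ y : E, polyWeight r y) := by
    rw [eLpNorm_one_eq_lintegral_enorm, ← ofReal_integral_norm_eq_lintegral_enorm h_int]
    simp only [norm_polyWeight]
    rw [integral_sub_left_eq_self (fun y => polyWeight r (t • y)),
      Measure.integral_comp_smul_of_nonneg _ _ _ (hR := ht.le), smul_eq_mul]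
  have h_nonneg : 0 ≤ (t ^ finrank ℝ E)⁻¹ * ∫ y : E, polyWeight r y :=
    mul_nonneg (by positivity) (integral_nonneg fun y => (polyWeight_pos y).le)
  refine (eLpNorm_le_rpow_eLpNorm_one ?_ hp).trans ?_
  · exact Eventually.of_forall fun y => (norm_polyWeight _).trans_le (polyWeight_le_one hr0 _)
  · rw [h_one, ENNReal.ofReal_rpow_of_nonneg h_nonneg ENNReal.toReal_nonneg]

lemma norm_integral_smul_le_of_norm_le_mul {α F : Type*} [MeasurableSpace α] {μ : Measure α}
    [NormedAddCommGroup F] [NormedSpace ℝ F] {p q : ENNReal} [p.HolderConjugate q] {u W : α → ℝ}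
    {f : α → F} {M : ℝ} (hu : MemLp u p μ) (hW : MemLp W q μ) (hf : ∀ a, ‖f a‖ ≤ M * ‖W a‖) :
    ‖∫ a, u a • f a ∂μ‖ ≤ M * ∫ a, ‖u a * W a‖ ∂μ := by
  rw [← integral_const_mul]
  refine norm_integral_le_of_norm_le ((hu.integrable_mul hW).norm.const_mul M)
    (Eventually.of_forall fun a => ?_)
  rw [norm_smul, norm_mul, mul_left_comm]
  exact mul_le_mul_of_nonneg_left (hf a) (norm_nonneg _)

lemma integral_norm_mul_le_of_holderConjugate {α : Type*} [MeasurableSpace α] {μ : Measure α}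
    {p q : ENNReal} [p.HolderConjugate q] {u W : α → ℝ} (hu : MemLp u p μ) (hW : MemLp W q μ) :
    ∫ a, ‖u a * W a‖ ∂μ ≤ (eLpNorm u p μ).toReal * (eLpNorm W q μ).toReal := by
  have h := integral_norm_eq_lintegral_enorm (f := fun a => u a * W a) (hu.1.mul hW.1)
  rw [← ENNReal.toReal_mul, h, ← eLpNorm_one_eq_lintegral_enorm]
  have h_holder : eLpNorm (u • W) 1 μ ≤ eLpNorm u p μ * eLpNorm W q μ :=
    eLpNorm_smul_le_mul_eLpNorm hW.1 hu.1
  exact ENNReal.toReal_mono (ENNReal.mul_ne_top hu.eLpNorm_ne_top hW.eLpNorm_ne_top) h_holder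

lemma toReal_inv_le_one (hp : 1 ≤ p) : p⁻¹.toReal ≤ 1 :=
  ENNReal.toReal_le_of_le_ofReal one_pos.le (by simpa using hp)

lemma toReal_inv_of_holderConjugate (p q : ENNReal) [p.HolderConjugate q] :
    q⁻¹.toReal = 1 - p⁻¹.toReal := by
  rw [← ENNReal.HolderConjugate.one_sub_inv p q, ENNReal.toReal_sub_of_le
    (ENNReal.inv_le_one.2 (ENNReal.HolderConjugate.one_le p q)) ENNReal.one_ne_top,
    ENNReal.toReal_one]

lemma mul_inv_mul_rpow_one_sub_le {t I a : ℝ} (ht : 0 < t) (hI : 0 ≤ I) (ha : 0 ≤ a) (ha1 : a ≤ 1) :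
    t * (t⁻¹ * I) ^ (1 - a) ≤ max 1 I * t ^ a := by
  have h_I : I ^ (1 - a) ≤ max 1 I :=
    (Real.rpow_le_rpow hI (le_max_right 1 I) (by linarith)).trans
      (Real.rpow_le_self_of_one_le (le_max_left _ _) (by linarith))
  calc t * (t⁻¹ * I) ^ (1 - a) = I ^ (1 - a) * t ^ a := by
        rw [Real.mul_rpow (by positivity) hI, Real.inv_rpow ht.le, Real.rpow_sub ht, Real.rpow_one]
        field_simp
    _ ≤ max 1 I * t ^ a := by gcongr

lemma norm_integral_smul_le_of_le_polyWeight {F : Type*} [NormedAddCommGroup F] [NormedSpace ℝ F]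
    (hr : finrank ℝ E < r) (hp : 1 ≤ p) (hu : MemLp u p) {A t : ℝ} (hA : 0 ≤ A) (ht : 0 < t)
    {K : E → F} (hK : ∀ z, ‖K z‖ ≤ A * t ^ finrank ℝ E * polyWeight r (t • z)) (x : E) :
    ‖∫ y, u y • K (x - y)‖ ≤ A * (max 1 (∫ y : E, polyWeight r y) *
      t ^ (finrank ℝ E * p⁻¹.toReal)) * (eLpNorm u p).toReal := by
  obtain ⟨q, hq⟩ : ∃ q, p.HolderConjugate q := ⟨p.conjExponent, .conjExponent hp⟩
  set I := ∫ y : E, polyWeight r y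
  have hI : 0 ≤ I := integral_nonneg fun y => (polyWeight_pos y).le
  have hWq := eLpNorm_polyWeight_smul_sub_le hr (ENNReal.HolderConjugate.one_le q p) ht x
  rw [toReal_inv_of_holderConjugate p q] at hWq
  have hW : MemLp (fun y => polyWeight r (t • (x - y))) q := by
    refine ⟨Continuous.aestronglyMeasurable ?_, hWq.trans_lt ENNReal.ofReal_lt_top⟩
    exact continuous_polyWeight.comp (by fun_prop)
  have h_scale := mul_inv_mul_rpow_one_sub_le (pow_pos ht (finrank ℝ E)) hI
    ENNReal.toReal_nonneg (toReal_inv_le_one hp)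
  rw [← Real.rpow_natCast, ← Real.rpow_mul ht.le, Real.rpow_natCast] at h_scale
  have hKW (y : E) : ‖K (x - y)‖ ≤ A * t ^ finrank ℝ E * ‖polyWeight r (t • (x - y))‖ :=
    (hK (x - y)).trans_eq (by rw [norm_polyWeight])
  refine (norm_integral_smul_le_of_norm_le_mul hu hW hKW).trans ?_
  have h_le := calc A * t ^ finrank ℝ E * ∫ y, ‖u y * polyWeight r (t • (x - y))‖
    _ ≤ A * t ^ finrank ℝ E * ((eLpNorm u p).toReal *
          ((t ^ finrank ℝ E)⁻¹ * I) ^ (1 - p⁻¹.toReal)) := by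
        gcongr
        refine (integral_norm_mul_le_of_holderConjugate hu hW).trans ?_
        gcongr
        exact ENNReal.toReal_le_of_le_ofReal (by positivity) hWq
    _ = A * (t ^ finrank ℝ E * ((t ^ finrank ℝ E)⁻¹ * I) ^ (1 - p⁻¹.toReal)) *
          (eLpNorm u p).toReal := by ring
    _ ≤ A * (max 1 I * t ^ (finrank ℝ E * p⁻¹.toReal)) * (eLpNorm u p).toReal := by gcongr
  exact h_le

end Holder

section Convolution

variable {E F : Type*} [NormedAddCommGroup E] [NormedSpace ℝ E] [NormedAddCommGroup F]
  [NormedSpace ℝ F] {r : ℝ} {u : E → ℝ} {K : E → F}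

lemma iteratedFDeriv_const_smul_comp_sub {n : ℕ} (hK : ContDiff ℝ n K) (c : ℝ) (y : E) :
    iteratedFDeriv ℝ n (fun x => c • K (x - y)) = fun x => c • iteratedFDeriv ℝ n K (x - y) := by
  ext1 x
  rw [iteratedFDeriv_const_smul_apply' (f := fun x => K (x - y))
      (hK.comp (contDiff_id.sub contDiff_const)).contDiffAt, iteratedFDeriv_comp_sub]

variable [MeasureSpace E] [BorelSpace E] [SecondCountableTopology E]

lemma SmoothDecay.smoothDominated_smul_sub (hK : SmoothDecay r K) (hr : 0 ≤ r)
    (hu : WeightIntegrable r u) : SmoothDominated volume fun y x => u y • K (x - y) where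
  contDiff y := contDiff_const.smul (hK.contDiff.comp (contDiff_id.sub contDiff_const))
  aestronglyMeasurable n x := by
    simp only [iteratedFDeriv_const_smul_comp_sub (contDiff_infty.1 hK.contDiff n)]
    exact hu.aestronglyMeasurable.smul ((hK.contDiff.continuous_iteratedFDeriv
      (mod_cast le_top)).comp (by fun_prop)).aestronglyMeasurable
  exists_bound n x := by
    obtain ⟨C, hC, h⟩ := isBigO_top_polyWeight_iff.1 (hK.isBigO_iteratedFDeriv n)
    refine ⟨ball x 1, ball_mem_nhds x one_pos, fun y => C * (2 + ‖x‖) ^ r * ‖polyWeight r y * u y‖,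
      hu.norm.const_mul _, Eventually.of_forall fun y z hz => ?_⟩
    have hzx : 1 + ‖z‖ ≤ 2 + ‖x‖ := by
      linarith [norm_le_norm_add_norm_sub' z x, (mem_ball_iff_norm.1 hz).le]
    have h_weight : polyWeight r (z - y) ≤ (2 + ‖x‖) ^ r * polyWeight r y :=
      (polyWeight_sub_le hr z y).trans (by have := polyWeight_pos (r := r) y; gcongr)
    simp only [iteratedFDeriv_const_smul_comp_sub (contDiff_infty.1 hK.contDiff n), norm_smul,
      norm_mul, norm_polyWeight]
    calc ‖u y‖ * ‖iteratedFDeriv ℝ n K (z - y)‖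
        ≤ ‖u y‖ * (C * ((2 + ‖x‖) ^ r * polyWeight r y)) := by
          gcongr
          exact (h _).trans (by gcongr)
      _ = C * (2 + ‖x‖) ^ r * (polyWeight r y * ‖u y‖) := by ring

lemma SmoothDecay.contDiff_integral_smul_sub (hK : SmoothDecay r K) (hr : 0 ≤ r)
    (hu : WeightIntegrable r u) : ContDiff ℝ ∞ fun x => ∫ y, u y • K (x - y) :=
  (hK.smoothDominated_smul_sub hr hu).contDiff_integral

lemma SmoothDecay.iteratedFDeriv_integral_smul_sub (hK : SmoothDecay r K) (hr : 0 ≤ r)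
    (hu : WeightIntegrable r u) (n : ℕ) (x : E) :
    iteratedFDeriv ℝ n (fun x => ∫ y, u y • K (x - y)) x =
      ∫ y, u y • iteratedFDeriv ℝ n K (x - y) := by
  rw [(hK.smoothDominated_smul_sub hr hu).iteratedFDeriv_integral]
  simp only [iteratedFDeriv_const_smul_comp_sub (contDiff_infty.1 hK.contDiff n)]

end Convolution

section SecondDiff

variable {E F : Type*} [AddCommGroup E] [NormedAddCommGroup F]

/-- The symmetric second difference `2 f(x) - f(x + h) - f(x - h)`, whose iterates are the
numerators of hypersingular integrals. -/
def secondDiff (h : E) (f : E → F) : E → F := fun x => 2 • f x - f (x + h) - f (x - h)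

lemma secondDiff_neg (h : E) : (secondDiff (-h) : (E → F) → E → F) = secondDiff h := by
  ext f x
  rw [secondDiff, secondDiff, sub_neg_eq_add, ← sub_eq_add_neg, sub_right_comm]

lemma secondDiff_iterate_comp {E' : Type*} [AddCommGroup E'] {g : E → E'} {h : E} {h' : E'}
    (hg : ∀ y, g (y + h) = g y + h') (m : ℕ) (f : E' → F) (x : E) :
    (secondDiff h)^[m] (fun y => f (g y)) x = (secondDiff h')^[m] f (g x) := by
  have hg_sub (y : E) : g (y - h) = g y - h' := by rw [eq_sub_iff_add_eq, ← hg, sub_add_cancel]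
  induction m generalizing x with
  | zero => rfl
  | succ m ih => simp only [Function.iterate_succ_apply', secondDiff, ih, hg, hg_sub]

lemma secondDiff_iterate_clm_comp {G : Type*} [NormedSpace ℝ F] [NormedAddCommGroup G]
    [NormedSpace ℝ G] (L : F →L[ℝ] G) (h : E) (m : ℕ) (f : E → F) (x : E) :
    (secondDiff h)^[m] (fun y => L (f y)) x = L ((secondDiff h)^[m] f x) := by
  induction m generalizing x with
  | zero => rfl
  | succ m ih => simp only [Function.iterate_succ_apply', secondDiff, ih, map_sub, map_nsmul]

lemma norm_secondDiff_iterate_le (h : E) (f : E → F) (m : ℕ) (x : E) :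
    ‖(secondDiff h)^[m] f x‖ ≤ 4 ^ m * ∑ j ∈ Finset.Icc (-m : ℤ) m, ‖f (x + j • h)‖ := by
  induction m generalizing x with
  | zero => simp
  | succ m ih =>
    have h_shift (i : ℤ) (hi : |i| ≤ 1) : ‖(secondDiff h)^[m] f (x + i • h)‖ ≤
        4 ^ m * ∑ j ∈ Finset.Icc (-(m + 1 : ℕ) : ℤ) (m + 1 : ℕ), ‖f (x + j • h)‖ := by
      have h_sum : ∑ j ∈ Finset.Icc (-m : ℤ) m, ‖f (x + i • h + j • h)‖ =
          ∑ j ∈ (Finset.Icc (-m : ℤ) m).map (addLeftEmbedding i), ‖f (x + j • h)‖ := by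
        simp only [Finset.sum_map, addLeftEmbedding_apply, add_smul, add_assoc]
      refine (ih _).trans (mul_le_mul_of_nonneg_left (h_sum.trans_le ?_) (by positivity))
      refine Finset.sum_le_sum_of_subset_of_nonneg (fun j hj => ?_) fun _ _ _ => norm_nonneg _
      obtain ⟨k, hk, rfl⟩ := Finset.mem_map.1 hj
      simp only [Finset.mem_Icc, addLeftEmbedding_apply, abs_le] at hk hi ⊢
      lia
    have h_zero := h_shift 0 (by simp)
    have h_one := h_shift 1 (by simp)
    have h_neg := h_shift (-1) (by simp)
    simp only [zero_smul, add_zero, one_smul, neg_smul, ← sub_eq_add_neg] at h_zero h_one h_neg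
    rw [Function.iterate_succ_apply', secondDiff, two_nsmul, pow_succ]
    refine (norm_sub_le_of_le (norm_sub_le_of_le (norm_add_le_of_le h_zero h_zero) h_one)
      h_neg).trans_eq (by ring)

lemma continuous_secondDiff_iterate {E : Type*} [NormedAddCommGroup E] {f : E → F}
    (hf : Continuous f) (m : ℕ) : Continuous fun p : E × E => (secondDiff p.1)^[m] f p.2 := by
  induction m with
  | zero => exact hf.comp continuous_snd
  | succ m ih =>
    simp only [Function.iterate_succ_apply', secondDiff]
    exact ((ih.const_smul 2).sub (ih.comp (by fun_prop : Continuous fun p : E × E =>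
      (p.1, p.2 + p.1)))).sub (ih.comp (by fun_prop : Continuous fun p : E × E =>
      (p.1, p.2 - p.1)))

end SecondDiff

section SecondDiffDeriv

variable {E F : Type*} [NormedAddCommGroup E] [NormedSpace ℝ E] [NormedAddCommGroup F]
  [NormedSpace ℝ F] {f : E → F}

lemma contDiff_secondDiff_iterate {n : ℕ∞ω} (hf : ContDiff ℝ n f) (h : E) (m : ℕ) :
    ContDiff ℝ n ((secondDiff h)^[m] f) := by
  induction m with
  | zero => exact hf
  | succ m ih =>
    rw [Function.iterate_succ_apply']
    exact ((ih.const_smul 2).sub (ih.comp (contDiff_id.add contDiff_const))).sub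
      (ih.comp (contDiff_id.sub contDiff_const))

lemma iteratedFDeriv_secondDiff (n : ℕ) (hf : ContDiff ℝ n f) (h x : E) :
    iteratedFDeriv ℝ n (secondDiff h f) x = secondDiff h (iteratedFDeriv ℝ n f) x := by
  have h_add : ContDiff ℝ n fun x => f (x + h) := hf.comp (contDiff_id.add contDiff_const)
  have h_sub : ContDiff ℝ n fun x => f (x - h) := hf.comp (contDiff_id.sub contDiff_const)
  have h_two : ContDiff ℝ n fun x => 2 • f x := hf.const_smul 2
  have h_two_sub : ContDiff ℝ n ((fun x => 2 • f x) - fun x => f (x + h)) := h_two.sub h_add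
  change iteratedFDeriv ℝ n (((fun x => 2 • f x) - fun x => f (x + h)) - fun x => f (x - h)) x = _
  rw [iteratedFDeriv_sub_apply h_two_sub.contDiffAt h_sub.contDiffAt,
    iteratedFDeriv_sub_apply h_two.contDiffAt h_add.contDiffAt,
    iteratedFDeriv_const_smul_apply' hf.contDiffAt, iteratedFDeriv_comp_add_right,
    iteratedFDeriv_comp_sub]
  rfl

lemma iteratedFDeriv_secondDiff_iterate (n m : ℕ) (hf : ContDiff ℝ n f) (h : E) :
    iteratedFDeriv ℝ n ((secondDiff h)^[m] f) = (secondDiff h)^[m] (iteratedFDeriv ℝ n f) := by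
  induction m with
  | zero => rfl
  | succ m ih =>
    ext1 x
    rw [Function.iterate_succ_apply', Function.iterate_succ_apply', ← ih,
      iteratedFDeriv_secondDiff n (contDiff_secondDiff_iterate hf h m)]

lemma norm_iteratedFDeriv_sub_le {n : ℕ} {C : ℝ} (hf : ContDiff ℝ (n + 1 : ℕ) f)
    (hC : ∀ x, ‖iteratedFDeriv ℝ (n + 1) f x‖ ≤ C) (x y : E) :
    ‖iteratedFDeriv ℝ n f x - iteratedFDeriv ℝ n f y‖ ≤ C * ‖x - y‖ :=
  convex_univ.norm_image_sub_le_of_norm_fderiv_le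
    (fun z _ => (hf.differentiable_iteratedFDeriv (mod_cast n.lt_succ_self)) z)
    (fun z _ => norm_fderiv_iteratedFDeriv.trans_le (hC z)) (mem_univ y) (mem_univ x)

lemma norm_iteratedFDeriv_secondDiff_le {n : ℕ} {C : ℝ} (hf : ContDiff ℝ (n + 2 : ℕ) f)
    (hC : ∀ x, ‖iteratedFDeriv ℝ (n + 2) f x‖ ≤ C) (h x : E) :
    ‖iteratedFDeriv ℝ n (secondDiff h f) x‖ ≤ ‖h‖ ^ 2 * C := by
  have hf1 : ContDiff ℝ (n + 1 : ℕ) f := hf.of_le (mod_cast (by lia))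
  have hf_shift : ContDiff ℝ (n + 1 : ℕ) fun y => f (y - h) :=
    hf1.comp (contDiff_id.sub contDiff_const)
  have h_diff (k : ℕ) (hk : k ≤ n + 1) (y : E) :
      iteratedFDeriv ℝ k (f - fun y => f (y - h)) y =
        iteratedFDeriv ℝ k f y - iteratedFDeriv ℝ k f (y - h) := by
    rw [iteratedFDeriv_sub_apply (hf1.of_le (mod_cast hk)).contDiffAt
      (hf_shift.of_le (mod_cast hk)).contDiffAt, iteratedFDeriv_comp_sub]
  have h_bound (y : E) : ‖iteratedFDeriv ℝ (n + 1) (f - fun y => f (y - h)) y‖ ≤ C * ‖h‖ := by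
    simpa only [h_diff _ le_rfl, sub_sub_cancel] using norm_iteratedFDeriv_sub_le hf hC y (y - h)
  calc ‖iteratedFDeriv ℝ n (secondDiff h f) x‖
      = ‖iteratedFDeriv ℝ n (f - fun y => f (y - h)) x -
          iteratedFDeriv ℝ n (f - fun y => f (y - h)) (x + h)‖ := by
        rw [iteratedFDeriv_secondDiff n (hf1.of_le (mod_cast n.le_succ)), h_diff n n.le_succ,
          h_diff n n.le_succ, add_sub_cancel_right, secondDiff]
        congr 1
        module
    _ ≤ C * ‖h‖ * ‖x - (x + h)‖ := norm_iteratedFDeriv_sub_le (hf1.sub hf_shift) h_bound _ _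
    _ = ‖h‖ ^ 2 * C := by
        rw [sub_add_cancel_left, norm_neg]
        ring

lemma norm_iteratedFDeriv_secondDiff_iterate_le {n m : ℕ} {C : ℝ} (hf : ContDiff ℝ ∞ f)
    (hC : ∀ x, ‖iteratedFDeriv ℝ (n + 2 * m) f x‖ ≤ C) (h x : E) :
    ‖iteratedFDeriv ℝ n ((secondDiff h)^[m] f) x‖ ≤ ‖h‖ ^ (2 * m) * C := by
  induction m generalizing f C x with
  | zero => simpa using hC x
  | succ m ih =>
    rw [Function.iterate_succ_apply]
    refine (ih (contDiff_secondDiff_iterate hf h 1)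
      (norm_iteratedFDeriv_secondDiff_le (contDiff_infty.1 hf _) hC h) x).trans_eq (by ring)

end SecondDiffDeriv

section BoundedDerivatives

variable {E F : Type*} [NormedAddCommGroup E] [NormedSpace ℝ E] [NormedAddCommGroup F]
  [NormedSpace ℝ F] {f : E → F}

lemma smoothDecay_of_hasCompactSupport [ProperSpace E] (hf : ContDiff ℝ ∞ f)
    (hfc : HasCompactSupport f) {r : ℝ} (hr : 0 ≤ r) : SmoothDecay r f where
  contDiff := hf
  isBigO_iteratedFDeriv n := by
    refine isBigO_top_polyWeight_of_cobounded hr (hf.continuous_iteratedFDeriv (mod_cast le_top))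
      (EventuallyEq.trans_isBigO ?_ (Asymptotics.isBigO_zero _ _))
    rw [cobounded_eq_cocompact, ← coclosedCompact_eq_cocompact]
    exact hasCompactSupport_iff_eventuallyEq.1 (hfc.iteratedFDeriv (𝕜 := ℝ) n)

lemma SmoothDecay.exists_norm_iteratedFDeriv_secondDiff_iterate_le (hf : SmoothDecay 0 f)
    (n m : ℕ) : ∃ C : ℝ, ∀ h x,
      ‖iteratedFDeriv ℝ n ((secondDiff h)^[m] f) x‖ ≤ C * min 1 (‖h‖ ^ (2 * m)) := by
  obtain ⟨A, _, h_zero⟩ := isBigO_top_polyWeight_iff.1 (hf.isBigO_iteratedFDeriv n)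
  obtain ⟨B, hB, h_top⟩ := isBigO_top_polyWeight_iff.1 (hf.isBigO_iteratedFDeriv (n + 2 * m))
  simp only [polyWeight, neg_zero, Real.rpow_zero, mul_one] at h_zero h_top
  refine ⟨max (4 ^ m * ((2 * m + 1 : ℕ) * A)) B, fun h x => ?_⟩
  rw [mul_min_of_nonneg _ _ (hB.le.trans (le_max_right _ _)), mul_one]
  refine le_min (le_max_of_le_left ?_) ?_
  · rw [iteratedFDeriv_secondDiff_iterate n m (contDiff_infty.1 hf.contDiff n)]
    refine (norm_secondDiff_iterate_le h _ m x).trans (mul_le_mul_of_nonneg_left ?_ (by positivity))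
    refine (Finset.sum_le_card_nsmul _ _ A fun j _ => h_zero _).trans_eq ?_
    rw [Int.card_Icc, nsmul_eq_mul]
    congr
    lia
  · refine (norm_iteratedFDeriv_secondDiff_iterate_le hf.contDiff h_top h x).trans ?_
    rw [mul_comm]
    gcongr
    exact le_max_right _ _

lemma iteratedFDeriv_const_smul_secondDiff_iterate (hf : ContDiff ℝ ∞ f) (c : ℝ) (n m : ℕ)
    (h x : E) : iteratedFDeriv ℝ n (fun x => c • (secondDiff h)^[m] f x) x =
      c • (secondDiff h)^[m] (iteratedFDeriv ℝ n f) x := by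
  rw [iteratedFDeriv_const_smul_apply' (contDiff_infty.1 (contDiff_secondDiff_iterate hf h m)
    n).contDiffAt, iteratedFDeriv_secondDiff_iterate n m (contDiff_infty.1 hf n)]

lemma norm_rpow_mul_norm_comp_add_zsmul_le {E F : Type*} [NormedAddCommGroup E]
    [NormedSpace ℝ E] [NormedAddCommGroup F] {g : E → F} {q B : ℝ} {m : ℕ} (hq : 0 ≤ q)
    (hB : 0 < B) (hg : ∀ y, B ≤ ‖y‖ → g y = 0) {x : E} (hx : 2 * B ≤ ‖x‖) {j : ℤ}
    (hj : |j| ≤ m) (h : E) :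
    ‖h‖ ^ (-q) * ‖g (x + j • h)‖ ≤ (2 * m) ^ q * ‖x‖ ^ (-q) * ‖g (x + j • h)‖ := by
  by_cases h_far : B ≤ ‖x + j • h‖
  · simp only [hg _ h_far, norm_zero, mul_zero, le_refl]
  have hx0 : 0 < ‖x‖ := by linarith
  have h_jh : ‖j • h‖ ≤ m * ‖h‖ := by
    rw [← Int.cast_smul_eq_zsmul ℝ, norm_smul, Real.norm_eq_abs]
    gcongr
    exact_mod_cast hj
  have h_tri : ‖x‖ ≤ ‖x + j • h‖ + ‖j • h‖ := by simpa using norm_sub_le (x + j • h) (j • h)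
  have h_low : ‖x‖ ≤ 2 * m * ‖h‖ := by linarith
  have hh : 0 < ‖h‖ := pos_of_mul_pos_right (hx0.trans_le h_low) (by positivity)
  gcongr
  rw [Real.rpow_neg hh.le, Real.rpow_neg hx0.le, ← div_eq_mul_inv,
    le_div_iff₀ (by positivity), inv_mul_le_iff₀ (by positivity), mul_comm,
    ← Real.mul_rpow (by positivity) hh.le]
  gcongr

end BoundedDerivatives

section Hypersingular

variable {E F : Type*} [NormedAddCommGroup E] [NormedSpace ℝ E] [FiniteDimensional ℝ E]
  [MeasureSpace E] [NormedAddCommGroup F] [NormedSpace ℝ F] {s : ℝ} {m : ℕ} {f : E → F}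

/-- The hypersingular integral `∫ ‖h‖^{-(d + 2s)} Δ_h^m f(x) dh` of order `2s`, where `Δ_h` is the
second difference with step `h`; for `s < m` it is a positive multiple of `(-Δ)^s f(x)`. -/
def hypersingular (s : ℝ) (m : ℕ) (f : E → F) (x : E) : F :=
  ∫ h : E, ‖h‖ ^ (-(finrank ℝ E + 2 * s)) • (secondDiff h)^[m] f x

variable [BorelSpace E] [(volume : Measure E).IsAddHaarMeasure]

lemma integral_norm_rpow_smul_comp_smul (q : ℝ) {t : ℝ} (ht : 0 < t) (g : E → F) :
    ∫ h : E, ‖h‖ ^ (-(finrank ℝ E + q)) • g (t • h) =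
      t ^ q • ∫ h : E, ‖h‖ ^ (-(finrank ℝ E + q)) • g h := by
  have h_subst := Measure.integral_comp_smul_of_nonneg volume
    (fun h : E => ‖h‖ ^ (-(finrank ℝ E + q)) • g h) t (hR := ht.le)
  simp only [norm_smul, Real.norm_of_nonneg ht.le, Real.mul_rpow ht.le (norm_nonneg _),
    mul_smul] at h_subst
  rw [integral_smul] at h_subst
  rw [← one_smul ℝ (∫ h : E, ‖h‖ ^ (-(finrank ℝ E + q)) • g (t • h)),
    ← Real.rpow_zero t, ← add_neg_cancel (finrank ℝ E + q), Real.rpow_add ht, mul_smul, h_subst,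
    smul_smul, ← Real.rpow_natCast, ← Real.rpow_neg ht.le, ← Real.rpow_add ht]
  congr 2
  ring

lemma integrableOn_rpow_mul_min (hs : 0 < s) (hm : s < m) :
    IntegrableOn (fun y : ℝ => y ^ (-1 - 2 * s) * min 1 (y ^ (2 * m))) (Ioi 0) := by
  rw [← Ioc_union_Ioi_eq_Ioi zero_le_one]
  have h_meas : Measurable fun y : ℝ => y ^ (-1 - 2 * s) * min 1 (y ^ (2 * m)) := by fun_prop
  refine IntegrableOn.union ?_ ?_
  · have h_pow : IntegrableOn (fun y : ℝ => y ^ (2 * (m - s) - 1)) (Ioc 0 1) := by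
      rw [← intervalIntegrable_iff_integrableOn_Ioc_of_le zero_le_one]
      exact intervalIntegral.intervalIntegrable_rpow' (by linarith)
    refine h_pow.mono' h_meas.aestronglyMeasurable ?_
    filter_upwards [ae_restrict_mem measurableSet_Ioc] with y hy
    have hy0 := hy.1
    rw [Real.norm_of_nonneg (by positivity), show 2 * (m - s) - 1 = -1 - 2 * s + (2 * m : ℕ) by
      push_cast; ring, Real.rpow_add hy0, Real.rpow_natCast]
    gcongr
    exact min_le_right _ _
  · refine (integrableOn_Ioi_rpow_of_lt (a := -1 - 2 * s) (by linarith) one_pos).mono'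
      h_meas.aestronglyMeasurable ?_
    filter_upwards [ae_restrict_mem measurableSet_Ioi] with y hy
    have hy0 : 0 < y := zero_lt_one.trans hy
    rw [Real.norm_of_nonneg (by positivity)]
    exact mul_le_of_le_one_right (by positivity) (min_le_left _ _)

lemma integrable_norm_rpow_mul_min [Nontrivial E] (hs : 0 < s) (hm : s < m) :
    Integrable fun h : E => ‖h‖ ^ (-(finrank ℝ E + 2 * s)) * min 1 (‖h‖ ^ (2 * m)) := by
  rw [integrable_fun_norm_addHaar (μ := volume)
    (f := fun y : ℝ => y ^ (-(finrank ℝ E + 2 * s)) * min 1 (y ^ (2 * m)))]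
  refine (integrableOn_rpow_mul_min hs hm).congr_fun (fun y hy => ?_) measurableSet_Ioi
  have h_pred : ((finrank ℝ E - 1 : ℕ) : ℝ) = finrank ℝ E - 1 := Nat.cast_pred finrank_pos
  rw [smul_eq_mul, ← mul_assoc, ← Real.rpow_natCast, ← Real.rpow_add hy, h_pred]
  ring_nf

lemma SmoothDecay.smoothDominated_hypersingular [Nontrivial E] (hf : SmoothDecay 0 f)
    (hs : 0 < s) (hm : s < m) : SmoothDominated volume fun h x : E =>
      ‖h‖ ^ (-(finrank ℝ E + 2 * s)) • (secondDiff h)^[m] f x where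
  contDiff h := contDiff_const.smul (contDiff_secondDiff_iterate hf.contDiff h m)
  aestronglyMeasurable n x := by
    simp only [iteratedFDeriv_const_smul_secondDiff_iterate hf.contDiff]
    exact ((measurable_norm.pow_const _).aestronglyMeasurable).smul
      ((continuous_secondDiff_iterate (hf.contDiff.continuous_iteratedFDeriv
        (mod_cast le_top)) m).comp (Continuous.prodMk_left x)).aestronglyMeasurable
  exists_bound n x := by
    obtain ⟨C, hC⟩ := hf.exists_norm_iteratedFDeriv_secondDiff_iterate_le n m
    refine ⟨univ, univ_mem, _, (integrable_norm_rpow_mul_min hs hm).mul_const C,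
      Eventually.of_forall fun h z _ => ?_⟩
    rw [iteratedFDeriv_const_smul_secondDiff_iterate hf.contDiff,
      ← iteratedFDeriv_secondDiff_iterate _ _ (contDiff_infty.1 hf.contDiff n), norm_smul,
      Real.norm_of_nonneg (by positivity), mul_assoc, mul_comm _ C]
    gcongr
    exact hC h z

lemma SmoothDecay.iteratedFDeriv_hypersingular [Nontrivial E] (hf : SmoothDecay 0 f)
    (hs : 0 < s) (hm : s < m) (n : ℕ) :
    iteratedFDeriv ℝ n (hypersingular s m f) = hypersingular s m (iteratedFDeriv ℝ n f) := by
  ext1 x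
  unfold hypersingular
  rw [(hf.smoothDominated_hypersingular hs hm).iteratedFDeriv_integral]
  simp only [iteratedFDeriv_const_smul_secondDiff_iterate hf.contDiff]

lemma integrable_norm_comp_add_zsmul {F : Type*} [NormedAddCommGroup F] {g : E → F}
    (hg : Integrable g) {x : E} (hx : g x = 0) (j : ℤ) :
    Integrable (fun h : E => ‖g (x + j • h)‖) ∧ ∫ h, ‖g (x + j • h)‖ ≤ ∫ y, ‖g y‖ := by
  rcases eq_or_ne j 0 with rfl | hj
  · simpa [hx] using integral_nonneg fun y => norm_nonneg (g y)
  have hj_ne : (j : ℝ) ≠ 0 := Int.cast_ne_zero.2 hj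
  have hj_one : 1 ≤ |(j : ℝ)| := mod_cast Int.one_le_abs hj
  simp only [← Int.cast_smul_eq_zsmul ℝ]
  refine ⟨((hg.comp_add_left x).comp_smul hj_ne).norm, ?_⟩
  rw [Measure.integral_comp_smul volume (fun y => ‖g (x + y)‖),
    integral_add_left_eq_self (fun y => ‖g y‖), smul_eq_mul, abs_inv, abs_pow]
  exact mul_le_of_le_one_left (integral_nonneg fun _ => norm_nonneg _)
    (inv_le_one_of_one_le₀ (one_le_pow₀ hj_one))

lemma isBigO_hypersingular_cobounded {g : E → F} (hg : Continuous g) (hgc : HasCompactSupport g)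
    (hs : 0 ≤ s) (m : ℕ) :
    hypersingular s m g =O[cobounded E] fun x => ‖x‖ ^ (-(finrank ℝ E + 2 * s)) := by
  obtain ⟨B, hB, h_supp⟩ := hgc.exists_pos_le_norm
  have h_int : Integrable g := hg.integrable_of_hasCompactSupport hgc
  set q := finrank ℝ E + 2 * s
  have hq : 0 ≤ q := by positivity
  refine Asymptotics.IsBigO.of_bound (4 ^ m * (2 * m) ^ q * ((2 * m + 1 : ℕ) * ∫ y, ‖g y‖)) ?_
  filter_upwards [eventually_cobounded_le_norm (2 * B)] with x hx
  have h_term (j : ℤ) := integrable_norm_comp_add_zsmul h_int (h_supp x (by linarith)) j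
  have h_bound (h : E) : ‖‖h‖ ^ (-q) • (secondDiff h)^[m] g x‖ ≤
      4 ^ m * ((2 * m) ^ q * ‖x‖ ^ (-q)) * ∑ j ∈ Finset.Icc (-m : ℤ) m, ‖g (x + j • h)‖ := by
    rw [norm_smul, Real.norm_of_nonneg (by positivity), mul_assoc]
    refine (mul_le_mul_of_nonneg_left (norm_secondDiff_iterate_le h g m x)
      (by positivity)).trans ?_
    rw [mul_left_comm, Finset.mul_sum]
    refine mul_le_mul_of_nonneg_left ?_ (by positivity)
    rw [Finset.mul_sum]
    refine Finset.sum_le_sum fun j hj => ?_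
    exact norm_rpow_mul_norm_comp_add_zsmul_le hq hB h_supp hx (abs_le.2 (Finset.mem_Icc.1 hj)) h
  refine (norm_integral_le_of_norm_le ((integrable_finsetSum _ fun j _ =>
    (h_term j).1).const_mul _) (Eventually.of_forall h_bound)).trans ?_
  have h_sum : ∑ j ∈ Finset.Icc (-m : ℤ) m, ∫ h, ‖g (x + j • h)‖ ≤
      (2 * m + 1 : ℕ) * ∫ y, ‖g y‖ := by
    refine (Finset.sum_le_card_nsmul _ _ _ fun j _ => (h_term j).2).trans_eq ?_
    rw [Int.card_Icc, nsmul_eq_mul]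
    congr
    lia
  rw [integral_const_mul, integral_finsetSum _ fun j _ => (h_term j).1,
    Real.norm_of_nonneg (by positivity)]
  refine (mul_le_mul_of_nonneg_left h_sum (by positivity)).trans_eq (by ring)

lemma smoothDecay_hypersingular [Nontrivial E] (hf : ContDiff ℝ ∞ f) (hfc : HasCompactSupport f)
    (hs : 0 < s) (hm : s < m) : SmoothDecay (finrank ℝ E + 2 * s) (hypersingular s m f) where
  contDiff := ((smoothDecay_of_hasCompactSupport hf hfc le_rfl).smoothDominated_hypersingular hs
    hm).contDiff_integral
  isBigO_iteratedFDeriv n := by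
    have hf0 := smoothDecay_of_hasCompactSupport hf hfc le_rfl
    have h_smooth : ContDiff ℝ ∞ (hypersingular s m f) :=
      (hf0.smoothDominated_hypersingular hs hm).contDiff_integral
    refine isBigO_top_polyWeight_of_cobounded (by positivity)
      (h_smooth.continuous_iteratedFDeriv (mod_cast le_top)) ?_
    rw [hf0.iteratedFDeriv_hypersingular hs hm]
    exact isBigO_hypersingular_cobounded (hf.continuous_iteratedFDeriv (mod_cast le_top))
      (hfc.iteratedFDeriv n) hs.le m

lemma hypersingular_comp_smul_sub {t : ℝ} (ht : 0 < t) (a x : E) :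
    hypersingular s m (fun y => f (t • (a - y))) x =
      t ^ (2 * s) • hypersingular s m f (t • (a - x)) := by
  have h_affine (h : E) : (secondDiff h)^[m] (fun y => f (t • (a - y))) x =
      (secondDiff (t • h))^[m] f (t • (a - x)) := by
    rw [secondDiff_iterate_comp (g := fun y => t • (a - y)) (h' := -(t • h))
      (fun y => by module), secondDiff_neg]
  simp only [hypersingular, h_affine]
  exact integral_norm_rpow_smul_comp_smul (2 * s) ht fun h => (secondDiff h)^[m] f (t • (a - x))

end Hypersingular

lemma hypersingular_comp_linearIsometryEquiv {E F : Type*} [NormedAddCommGroup E]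
    [InnerProductSpace ℝ E] [FiniteDimensional ℝ E] [MeasurableSpace E] [BorelSpace E]
    [NormedAddCommGroup F] [NormedSpace ℝ F] (s : ℝ) (m : ℕ) (f : E → F)
    (A : E ≃ₗᵢ[ℝ] E) (x : E) :
    hypersingular s m (fun y => f (A y)) x = hypersingular s m f (A x) := by
  simp only [hypersingular, secondDiff_iterate_comp (fun y => map_add A y _)]
  simpa only [LinearIsometryEquiv.norm_map] using A.measurePreserving.integral_comp
    A.toHomeomorph.measurableEmbedding
    fun h => ‖h‖ ^ (-(finrank ℝ E + 2 * s)) • (secondDiff h)^[m] f (A x)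

section FourierSymbol

variable {E F : Type*} [NormedAddCommGroup E] [InnerProductSpace ℝ E] [FiniteDimensional ℝ E]
  [MeasurableSpace E] [BorelSpace E] [NormedAddCommGroup F] [NormedSpace ℂ F] {s : ℝ} {m : ℕ}

lemma two_sub_two_cos_nonneg (a : ℝ) : 0 ≤ 2 - 2 * Real.cos a := by
  linarith [Real.cos_le_one a]

lemma two_sub_two_cos_pow_le (a : ℝ) (m : ℕ) :
    (2 - 2 * Real.cos a) ^ m ≤ min (4 ^ m) (|a| ^ (2 * m)) := by
  have h_nonneg := two_sub_two_cos_nonneg a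
  refine le_min ?_ ?_
  · gcongr
    linarith [Real.neg_one_le_cos a]
  · rw [pow_mul, sq_abs]
    gcongr
    linarith [Real.one_sub_sq_div_two_le_cos (x := a)]

lemma two_sub_fourierChar_sub_fourierChar_neg (a : ℝ) :
    (2 : ℂ) - 𝐞 a - 𝐞 (-a) = (2 - 2 * Real.cos (2 * Real.pi * a) : ℝ) := by
  simp only [Real.fourierChar_apply, Complex.ofReal_sub, Complex.ofReal_mul, Complex.ofReal_cos,
    Complex.ofReal_ofNat, Complex.cos, mul_neg, Complex.ofReal_neg, neg_mul]
  ring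

lemma integrable_two_sub_two_cos_pow_smul {F : Type*} [NormedAddCommGroup F] [NormedSpace ℝ F]
    {g : E → F} (hg : Integrable g) (h : E) (m : ℕ) :
    Integrable fun ξ => (2 - 2 * Real.cos (2 * Real.pi * inner ℝ ξ h)) ^ m • g ξ := by
  have h_meas : AEStronglyMeasurable
      (fun ξ : E => (2 - 2 * Real.cos (2 * Real.pi * inner ℝ ξ h)) ^ m) volume :=
    Continuous.aestronglyMeasurable (by fun_prop)
  refine hg.bdd_smul (4 ^ m) h_meas (Eventually.of_forall fun ξ => ?_)
  rw [Real.norm_of_nonneg (pow_nonneg (two_sub_two_cos_nonneg _) m)]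
  exact (two_sub_two_cos_pow_le _ m).trans (min_le_left _ _)

lemma secondDiff_fourierInv {g : E → F} (hg : Integrable g) (h : E) :
    secondDiff h (𝓕⁻ g) =
      𝓕⁻ fun ξ => (2 - 2 * Real.cos (2 * Real.pi * inner ℝ ξ h)) • g ξ := by
  have h_int (y : E) : Integrable fun ξ => 𝐞 (inner ℝ ξ y) • g ξ := by
    simpa using (Real.fourierIntegral_convergent_iff (V := E) (f := g) (-y)).2 hg
  ext1 x
  simp only [secondDiff, Real.fourierInv_eq]
  rw [sub_sub, ← integral_add (h_int _) (h_int _), two_nsmul, ← integral_add (h_int x) (h_int x),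
    ← integral_sub ((h_int x).fun_add (h_int x)) ((h_int _).fun_add (h_int _))]
  congr with ξ
  simp only [inner_add_right, inner_sub_right, sub_eq_add_neg (inner ℝ ξ x),
    AddChar.map_add_eq_mul, Circle.smul_def, Circle.coe_mul]
  rw [← Complex.coe_smul, ← two_sub_fourierChar_sub_fourierChar_neg]
  module

lemma secondDiff_iterate_fourierInv {g : E → F} (hg : Integrable g) (h : E) (m : ℕ) :
    (secondDiff h)^[m] (𝓕⁻ g) =
      𝓕⁻ fun ξ => (2 - 2 * Real.cos (2 * Real.pi * inner ℝ ξ h)) ^ m • g ξ := by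
  induction m with
  | zero => simp
  | succ m ih =>
    rw [Function.iterate_succ_apply', ih,
      secondDiff_fourierInv (integrable_two_sub_two_cos_pow_smul hg h m)]
    simp only [smul_smul, pow_succ']

/-- The Fourier multiplier of `hypersingular s m`. -/
def hyperSymbol (s : ℝ) (m : ℕ) (ξ : E) : ℝ :=
  ∫ h : E, ‖h‖ ^ (-(finrank ℝ E + 2 * s)) * (2 - 2 * Real.cos (2 * Real.pi * inner ℝ ξ h)) ^ m

lemma integrable_hyperSymbol [Nontrivial E] (hs : 0 < s) (hm : s < m) (ξ : E) :
    Integrable fun h : E =>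
      ‖h‖ ^ (-(finrank ℝ E + 2 * s)) * (2 - 2 * Real.cos (2 * Real.pi * inner ℝ ξ h)) ^ m := by
  set A : ℝ := max (4 ^ m) ((2 * Real.pi * ‖ξ‖) ^ (2 * m))
  refine ((integrable_norm_rpow_mul_min (E := E) hs hm).const_mul A).mono'
    (Measurable.aestronglyMeasurable (by fun_prop)) (Eventually.of_forall fun h => ?_)
  have h_inner : |2 * Real.pi * inner ℝ ξ h| ≤ 2 * Real.pi * ‖ξ‖ * ‖h‖ := by
    rw [abs_mul, abs_of_pos Real.two_pi_pos]
    exact mul_le_mul_of_nonneg_left (abs_real_inner_le_norm ξ h) Real.two_pi_pos.le |>.trans_eq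
      (mul_assoc _ _ _).symm
  have h_nonneg := two_sub_two_cos_nonneg (2 * Real.pi * inner ℝ ξ h)
  rw [Real.norm_of_nonneg (by positivity), mul_left_comm]
  gcongr
  rw [mul_min_of_nonneg _ _ (by positivity), mul_one]
  refine (two_sub_two_cos_pow_le _ m).trans (min_le_min (le_max_left _ _) ?_)
  refine (pow_le_pow_left₀ (abs_nonneg _) h_inner _).trans ?_
  rw [mul_pow]
  gcongr
  exact le_max_right _ _

lemma hyperSymbol_smul (s : ℝ) (m : ℕ) {t : ℝ} (ht : 0 < t) (ξ : E) :
    hyperSymbol s m (t • ξ) = t ^ (2 * s) * hyperSymbol s m ξ := by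
  simpa only [hyperSymbol, inner_smul_left, inner_smul_right, RCLike.conj_to_real, smul_eq_mul]
    using integral_norm_rpow_smul_comp_smul (2 * s) ht
      fun h : E => (2 - 2 * Real.cos (2 * Real.pi * inner ℝ ξ h)) ^ m

lemma hyperSymbol_linearIsometryEquiv (s : ℝ) (m : ℕ) (A : E ≃ₗᵢ[ℝ] E) (ξ : E) :
    hyperSymbol s m (A ξ) = hyperSymbol s m ξ := by
  unfold hyperSymbol
  rw [← A.measurePreserving.integral_comp A.toHomeomorph.measurableEmbedding]
  simp only [LinearIsometryEquiv.norm_map, LinearIsometryEquiv.inner_map_map]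

lemma exists_linearIsometryEquiv_apply_eq {E : Type*} [NormedAddCommGroup E]
    [InnerProductSpace ℝ E] {x y : E} (h : ‖x‖ = ‖y‖) :
    ∃ A : E ≃ₗᵢ[ℝ] E, A x = y :=
  ⟨_, Submodule.reflection_sub h⟩

lemma hyperSymbol_pos [Nontrivial E] (hs : 0 < s) (hm : s < m) {ξ : E} (hξ : ξ ≠ 0) :
    0 < hyperSymbol s m ξ := by
  have h_nonneg (h : E) : 0 ≤ ‖h‖ ^ (-(finrank ℝ E + 2 * s)) *
      (2 - 2 * Real.cos (2 * Real.pi * inner ℝ ξ h)) ^ m :=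
    mul_nonneg (by positivity) (pow_nonneg (two_sub_two_cos_nonneg _) m)
  rw [hyperSymbol, integral_pos_iff_support_of_nonneg h_nonneg (integrable_hyperSymbol hs hm ξ)]
  set U : Set E := {h | Real.cos (2 * Real.pi * inner ℝ ξ h) < 0} with hU
  have hU_open : IsOpen U := isOpen_lt (by fun_prop) continuous_const
  have hU_nonempty : U.Nonempty := by
    refine ⟨(2 * ‖ξ‖ ^ 2)⁻¹ • ξ, ?_⟩
    have h_arg : 2 * Real.pi * ((2 * ‖ξ‖ ^ 2)⁻¹ * ‖ξ‖ ^ 2) = Real.pi := by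
      have : ‖ξ‖ ≠ 0 := norm_ne_zero_iff.2 hξ
      field_simp
    simp only [hU, Set.mem_ofPred_eq, inner_smul_right, real_inner_self_eq_norm_sq, h_arg,
      Real.cos_pi, Left.neg_neg_iff, zero_lt_one]
  refine (hU_open.measure_pos volume hU_nonempty).trans_le (measure_mono fun h hh => ?_)
  have h0 : h ≠ 0 := by
    rintro rfl
    simp only [hU, Set.mem_ofPred_eq, inner_zero_right, mul_zero, Real.cos_zero] at hh
    linarith
  have h_pos : 0 < 2 - 2 * Real.cos (2 * Real.pi * inner ℝ ξ h) := by
    linarith [show Real.cos (2 * Real.pi * inner ℝ ξ h) < 0 from hh]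
  have h_norm := norm_pos_iff.2 h0
  exact (mul_pos (Real.rpow_pos_of_pos h_norm _) (pow_pos h_pos m)).ne'

lemma exists_hyperSymbol_eq [Nontrivial E] (hs : 0 < s) (hm : s < m) :
    ∃ κ > 0, ∀ ξ : E, hyperSymbol s m ξ = κ * (2 * Real.pi * ‖ξ‖) ^ (2 * s) := by
  obtain ⟨e, he⟩ := exists_norm_eq E zero_le_one
  have h_two_pi : 0 < (2 * Real.pi) ^ (2 * s) := by positivity
  refine ⟨hyperSymbol s m e / (2 * Real.pi) ^ (2 * s),
    div_pos (hyperSymbol_pos hs hm (norm_ne_zero_iff.1 (he ▸ one_ne_zero))) h_two_pi, fun ξ => ?_⟩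
  rcases eq_or_ne ξ 0 with rfl | hξ
  · have hm0 : m ≠ 0 := by
      rintro rfl
      exact (hs.trans hm).ne' Nat.cast_zero
    simp [hyperSymbol, hm0, Real.zero_rpow (by positivity : 2 * s ≠ 0)]
  · obtain ⟨A, hA⟩ : ∃ A : E ≃ₗᵢ[ℝ] E, A (‖ξ‖ • e) = ξ :=
      exists_linearIsometryEquiv_apply_eq (by rw [norm_smul, norm_norm, he, mul_one])
    rw [← hA, hyperSymbol_linearIsometryEquiv, hyperSymbol_smul s m (norm_pos_iff.2 hξ),
      A.norm_map, norm_smul, norm_norm, he, mul_one, Real.mul_rpow (by positivity) (norm_nonneg ξ)]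
    field_simp

lemma integrable_rpow_norm_mul_norm (g : SchwartzMap E F) {a : ℝ} (ha : 0 ≤ a) :
    Integrable fun ξ => ‖ξ‖ ^ a * ‖g ξ‖ := by
  refine ((g.integrable_pow_mul volume 0).add (g.integrable_pow_mul volume ⌈a⌉₊)).mono'
    ((continuous_norm.rpow_const fun _ => Or.inr ha).mul
      g.continuous.norm).aestronglyMeasurable (Eventually.of_forall fun ξ => ?_)
  rw [Real.norm_of_nonneg (by positivity), Pi.add_apply, ← add_mul, pow_zero]
  gcongr
  rcases le_total ‖ξ‖ 1 with h_le | h_le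
  · exact (Real.rpow_le_one (norm_nonneg ξ) h_le ha).trans
      (le_add_of_nonneg_right (by positivity))
  · rw [← Real.rpow_natCast]
    exact (Real.rpow_le_rpow_of_exponent_le h_le (Nat.le_ceil a)).trans
      (le_add_of_nonneg_left zero_le_one)

lemma integrable_hyperSymbol_smul [Nontrivial E] (hs : 0 < s) (hm : s < m)
    (g : SchwartzMap E F) (x : E) :
    Integrable (Function.uncurry fun h ξ : E => (‖h‖ ^ (-(finrank ℝ E + 2 * s)) *
      (2 - 2 * Real.cos (2 * Real.pi * inner ℝ ξ h)) ^ m) • 𝐞 (inner ℝ ξ x) • g ξ)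
      (volume.prod volume) := by
  obtain ⟨κ, _, hκ⟩ := exists_hyperSymbol_eq (E := E) hs hm
  have h_nonneg (h ξ : E) : 0 ≤ ‖h‖ ^ (-(finrank ℝ E + 2 * s)) *
      (2 - 2 * Real.cos (2 * Real.pi * inner ℝ ξ h)) ^ m :=
    mul_nonneg (by positivity) (pow_nonneg (two_sub_two_cos_nonneg _) m)
  have h_meas : Measurable fun p : E × E => ‖p.1‖ ^ (-(finrank ℝ E + 2 * s)) *
      (2 - 2 * Real.cos (2 * Real.pi * inner ℝ p.2 p.1)) ^ m := by fun_prop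
  have h_cont : Continuous fun p : E × E => 𝐞 (inner ℝ p.2 x) • g p.2 := by
    have := g.continuous
    fun_prop
  have h_aesm := h_meas.aestronglyMeasurable.smul h_cont.aestronglyMeasurable (μ := volume)
  rw [integrable_prod_iff' (by exact h_aesm)]
  refine ⟨Eventually.of_forall fun ξ =>
    (integrable_hyperSymbol hs hm ξ).smul_const (𝐞 (inner ℝ ξ x) • g ξ), ?_⟩
  simp only [Function.uncurry, norm_smul, Circle.norm_smul,
    Real.norm_of_nonneg (h_nonneg _ _), integral_mul_const]
  refine ((integrable_rpow_norm_mul_norm g (a := 2 * s) (by positivity)).const_mul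
    (κ * (2 * Real.pi) ^ (2 * s))).congr (Eventually.of_forall fun ξ => ?_)
  change _ = hyperSymbol s m ξ * ‖g ξ‖
  rw [hκ, Real.mul_rpow Real.two_pi_pos.le (norm_nonneg _)]
  ring

lemma hypersingular_eq_fourierInv [CompleteSpace F] [Nontrivial E] (hs : 0 < s) (hm : s < m)
    (φ : SchwartzMap E F) :
    hypersingular s m φ = 𝓕⁻ fun ξ => hyperSymbol s m ξ • 𝓕 ⇑φ ξ := by
  have h_inv : 𝓕⁻ (𝓕 φ : SchwartzMap E F) = φ := FourierTransform.fourierInv_fourier_eq φ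
  have h_diff (h x : E) : (secondDiff h)^[m] φ x = 𝓕⁻ (fun ξ =>
      (2 - 2 * Real.cos (2 * Real.pi * inner ℝ ξ h)) ^ m • 𝓕 ⇑φ ξ) x := by
    rw [← secondDiff_iterate_fourierInv (SchwartzMap.fourier_coe φ ▸ (𝓕 φ).integrable),
      ← SchwartzMap.fourier_coe, ← SchwartzMap.fourierInv_coe, h_inv]
  ext1 x
  have h_fubini := integral_integral_swap (integrable_hyperSymbol_smul hs hm (𝓕 φ) x)
  simp only [mul_smul, SchwartzMap.fourier_coe] at h_fubini
  simp only [hypersingular, h_diff, Real.fourierInv_eq, ← integral_smul]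
  simp only [smul_comm (𝐞 _)]
  refine h_fubini.trans (integral_congr_ae (Eventually.of_forall fun ξ => ?_))
  simp only [smul_smul, integral_smul_const, hyperSymbol]

end FourierSymbol

lemma exists_schwartzMap_eq_ofReal {E : Type*} [NormedAddCommGroup E] [NormedSpace ℝ E]
    {f : E → ℝ} (hf : ContDiff ℝ ∞ f) (hfc : HasCompactSupport f) :
    ∃ φ : SchwartzMap E ℂ, ⇑φ = fun x => (f x : ℂ) :=
  ⟨(hfc.comp_left Complex.ofReal_zero).toSchwartzMap (Complex.ofRealCLM.contDiff.comp hf), rfl⟩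

section FourierTransformOfHypersingular

variable {E : Type*} [NormedAddCommGroup E] [InnerProductSpace ℝ E] [FiniteDimensional ℝ E]
  [MeasurableSpace E] [BorelSpace E] {s : ℝ} {m : ℕ} {f : E → ℝ}

lemma hypersingular_ofReal (s : ℝ) (m : ℕ) (f : E → ℝ) (x : E) :
    hypersingular s m (fun y => (f y : ℂ)) x = hypersingular s m f x := by
  have h_diff (h : E) := secondDiff_iterate_clm_comp Complex.ofRealCLM h m f x
  simp only [Complex.ofRealCLM_apply] at h_diff
  simp only [hypersingular, h_diff, ← integral_complex_ofReal, Complex.real_smul,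
    Complex.ofReal_mul, smul_eq_mul]

variable [Nontrivial E]

lemma hypersingular_ofReal_eq_fourierInv (hf : ContDiff ℝ ∞ f) (hfc : HasCompactSupport f)
    (hs : 0 < s) (hm : s < m) : (fun x => ((hypersingular s m f x : ℝ) : ℂ)) =
      𝓕⁻ fun ξ => hyperSymbol s m ξ • 𝓕 (fun x => (f x : ℂ)) ξ := by
  obtain ⟨φ, hφ⟩ := exists_schwartzMap_eq_ofReal hf hfc
  rw [← hφ, ← hypersingular_eq_fourierInv hs hm, hφ]
  ext1 x
  rw [hypersingular_ofReal]

lemma integrable_hypersingular (hf : ContDiff ℝ ∞ f) (hfc : HasCompactSupport f)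
    (hs : 0 < s) (hm : s < m) : Integrable (hypersingular s m f) :=
  (smoothDecay_hypersingular hf hfc hs hm).integrable (by linarith)

lemma fourier_hypersingular (hf : ContDiff ℝ ∞ f) (hfc : HasCompactSupport f)
    (hs : 0 < s) (hm : s < m) :
    𝓕 (fun x => ((hypersingular s m f x : ℝ) : ℂ)) =
      fun ξ => hyperSymbol s m ξ • 𝓕 (fun x => (f x : ℂ)) ξ := by
  obtain ⟨φ, hφ⟩ := exists_schwartzMap_eq_ofReal hf hfc
  obtain ⟨κ, hκ, h_symbol⟩ := exists_hyperSymbol_eq (E := E) hs hm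
  have h_inv := hypersingular_ofReal_eq_fourierInv hf hfc hs hm
  set g : E → ℂ := fun ξ => hyperSymbol s m ξ • 𝓕 (fun x => (f x : ℂ)) ξ with hg
  have hg_eq : g = fun ξ => (κ * (2 * Real.pi * ‖ξ‖) ^ (2 * s)) • (𝓕 φ) ξ := by
    simp only [hg, h_symbol, SchwartzMap.fourier_coe, hφ]
  have hg_cont : Continuous g := by
    have h_pow : Continuous fun ξ : E => (2 * Real.pi * ‖ξ‖) ^ (2 * s) :=
      (by fun_prop : Continuous fun ξ : E => 2 * Real.pi * ‖ξ‖).rpow_const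
        fun _ => Or.inr (by positivity)
    rw [hg_eq]
    exact (h_pow.const_mul κ).smul (𝓕 φ).continuous
  have hg_int : Integrable g := by
    refine ((integrable_rpow_norm_mul_norm (𝓕 φ) (a := 2 * s) (by positivity)).const_mul
      (κ * (2 * Real.pi) ^ (2 * s))).mono' hg_cont.aestronglyMeasurable
      (Eventually.of_forall fun ξ => le_of_eq ?_)
    rw [hg_eq, norm_smul, Real.norm_of_nonneg (by positivity),
      Real.mul_rpow Real.two_pi_pos.le (norm_nonneg _)]
    ring
  have hg_fourier : 𝓕 g = fun x => ((hypersingular s m f (-x) : ℝ) : ℂ) := by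
    ext x
    rw [congrFun h_inv (-x), Real.fourierInv_eq_fourier_neg, neg_neg]
  rw [h_inv, hg_cont.fourier_fourierInv_eq hg_int]
  rw [hg_fourier]
  exact (integrable_hypersingular hf hfc hs hm).comp_neg.ofReal

lemma integral_hypersingular_eq_zero (hf : ContDiff ℝ ∞ f) (hfc : HasCompactSupport f)
    (hs : 0 < s) (hm : s < m) : ∫ x, hypersingular s m f x = 0 := by
  obtain ⟨κ, _, h_symbol⟩ := exists_hyperSymbol_eq (E := E) hs hm
  have h_zero := congrFun (fourier_hypersingular hf hfc hs hm) 0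
  rw [h_symbol, Real.fourier_eq, norm_zero, mul_zero, Real.zero_rpow (by positivity), mul_zero,
    zero_smul] at h_zero
  simp only [inner_zero_right, neg_zero, AddChar.map_zero_eq_one, one_smul,
    integral_complex_ofReal, Complex.ofReal_eq_zero] at h_zero
  exact h_zero

end FourierTransformOfHypersingular

lemma exists_fracLaplacian_eq_hypersingular {d : ℕ} [NeZero d] {s : ℝ} {m : ℕ} (hs : 0 < s)
    (hm : s < m) : ∃ κ > 0, ∀ φ : EuclideanSpace ℝ (Fin d) → ℝ, ContDiff ℝ ∞ φ →
      HasCompactSupport φ → ∀ x, fracLaplacian s φ x = ((κ * hypersingular s m φ x : ℝ) : ℂ) := by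
  obtain ⟨κ, hκ, h_symbol⟩ := exists_hyperSymbol_eq (E := EuclideanSpace ℝ (Fin d)) hs hm
  refine ⟨κ⁻¹, inv_pos.2 hκ, fun φ hφ hφc x => ?_⟩
  rw [Complex.ofReal_mul, congrFun (hypersingular_ofReal_eq_fourierInv hφ hφc hs hm) x,
    fracLaplacian, Real.fourierInv_eq, Real.fourierInv_eq, ← integral_const_mul]
  congr with ξ
  have h_cancel : ((κ⁻¹ * κ : ℝ) : ℂ) = 1 := by rw [inv_mul_cancel₀ hκ.ne', Complex.ofReal_one]
  rw [h_symbol, Circle.smul_def, Circle.smul_def, smul_eq_mul, smul_eq_mul, Complex.real_smul]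
  push_cast at h_cancel ⊢
  linear_combination
    (𝐞 (inner ℝ ξ x) * ((2 * Real.pi * ‖ξ‖) ^ (2 * s) : ℝ) * 𝓕 (fun x => (φ x : ℂ)) ξ) * -h_cancel

section DilationAverage

variable {E F : Type*} [NormedAddCommGroup E] [NormedSpace ℝ E] [NormedAddCommGroup F]
  [NormedSpace ℝ F] {f : E → F} {k : ℕ} {r : ℝ}

/-- The weighted average `∫₀¹ λ^k f(λ x) dλ` of the dilations of `f`. For `k = d - 1` it turns `f`
into the kernel `ρ` with `d/dt [t^d ρ(t x)] = t^{d-1} f(t x)`. -/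
def dilationAverage (k : ℕ) (f : E → F) (x : E) : F :=
  ∫ t : ℝ in 0..1, t ^ k • f (t • x)

lemma dilationAverage_eq_setIntegral (k : ℕ) (f : E → F) :
    dilationAverage k f = fun x => ∫ t : ℝ in Ioc 0 1, t ^ k • f (t • x) := by
  ext1 x
  exact intervalIntegral.integral_of_le zero_le_one

lemma SmoothDecay.smoothDominated_pow_smul_comp_smul (hf : SmoothDecay 0 f) (k : ℕ) :
    SmoothDominated (volume.restrict (Ioc (0 : ℝ) 1)) fun (t : ℝ) x => t ^ k • f (t • x) where
  contDiff t := contDiff_const.smul (hf.contDiff.comp (contDiff_const_smul t))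
  aestronglyMeasurable n x := by
    have h_cont := hf.contDiff.continuous_iteratedFDeriv (m := n) (mod_cast le_top)
    simp only [iteratedFDeriv_const_smul_comp_smul (contDiff_infty.1 hf.contDiff n)]
    exact Continuous.aestronglyMeasurable (by fun_prop)
  exists_bound n x := by
    obtain ⟨C, _, h_bound⟩ := isBigO_top_polyWeight_iff.1 (hf.isBigO_iteratedFDeriv n)
    simp only [polyWeight, neg_zero, Real.rpow_zero, mul_one] at h_bound
    refine ⟨univ, univ_mem, fun _ => C, integrable_const C, ?_⟩
    filter_upwards [ae_restrict_mem measurableSet_Ioc] with t ht z _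
    rw [iteratedFDeriv_const_smul_comp_smul (contDiff_infty.1 hf.contDiff n), norm_smul,
      ← pow_add, norm_pow, Real.norm_of_nonneg ht.1.le]
    exact (mul_le_of_le_one_left (norm_nonneg _) (pow_le_one₀ ht.1.le ht.2)).trans (h_bound _)

lemma SmoothDecay.iteratedFDeriv_dilationAverage (hf : SmoothDecay 0 f) (k n : ℕ) :
    iteratedFDeriv ℝ n (dilationAverage k f) =
      dilationAverage (k + n) (iteratedFDeriv ℝ n f) := by
  rw [dilationAverage_eq_setIntegral, dilationAverage_eq_setIntegral,
    (hf.smoothDominated_pow_smul_comp_smul k).iteratedFDeriv_integral]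
  simp only [iteratedFDeriv_const_smul_comp_smul (contDiff_infty.1 hf.contDiff n), pow_add]

lemma isBigO_dilationAverage (hr : 0 ≤ r) (hrk : r < k + 1)
    (hf : f =O[⊤] (polyWeight r : E → ℝ)) :
    dilationAverage k f =O[⊤] (polyWeight r : E → ℝ) := by
  obtain ⟨C, hC, h_bound⟩ := isBigO_top_polyWeight_iff.1 hf
  have h_int : IntervalIntegrable (fun t : ℝ => t ^ (k - r)) volume 0 1 :=
    intervalIntegral.intervalIntegrable_rpow' (by linarith)
  refine Asymptotics.isBigO_top.2 ⟨∫ t : ℝ in 0..1, C * t ^ (k - r), fun x => ?_⟩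
  rw [norm_polyWeight, ← intervalIntegral.integral_mul_const]
  refine intervalIntegral.norm_integral_le_of_norm_le zero_le_one
    (Eventually.of_forall fun t ht => ?_) ((h_int.const_mul C).mul_const _)
  rw [norm_smul, norm_pow, Real.norm_of_nonneg ht.1.le]
  have h_le : ‖f (t • x)‖ ≤ C * (t⁻¹ ^ r * polyWeight r x) := (h_bound _).trans
    (mul_le_mul_of_nonneg_left (polyWeight_smul_le hr ht.1 ht.2 le_rfl x) hC.le)
  refine (mul_le_mul_of_nonneg_left h_le (pow_nonneg ht.1.le k)).trans_eq ?_
  rw [Real.rpow_sub ht.1, Real.rpow_natCast, Real.inv_rpow ht.1.le]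
  ring

end DilationAverage

section RadialDilationAverage

variable {E F : Type*} [NormedAddCommGroup E] [NormedSpace ℝ E] [FiniteDimensional ℝ E]
  [MeasureSpace E] [BorelSpace E] [(volume : Measure E).IsAddHaarMeasure] [Nontrivial E]
  [NormedAddCommGroup F] [NormedSpace ℝ F] {f : E → F} {r : ℝ}

lemma integral_Ioi_pow_smul_of_radial (hrad : ∀ x y, ‖x‖ = ‖y‖ → f x = f y) (hf : Integrable f)
    (h0 : ∫ x, f x = 0) {x : E} (hx : x ≠ 0) :
    IntegrableOn (fun t : ℝ => t ^ (finrank ℝ E - 1) • f (t • x)) (Ioi 0) ∧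
      ∫ t : ℝ in Ioi 0, t ^ (finrank ℝ E - 1) • f (t • x) = 0 := by
  have h_norm : ‖x‖ ≠ 0 := norm_ne_zero_iff.2 hx
  have h_profile : (fun y => f (‖x‖ • y)) = fun y => f (‖y‖ • x) := by
    ext1 y
    exact hrad _ _ (by rw [norm_smul, norm_smul, norm_norm, norm_norm, mul_comm])
  have h_int : Integrable fun y : E => f (‖y‖ • x) := h_profile ▸ hf.comp_smul h_norm
  have h_zero : ∫ y : E, f (‖y‖ • x) = 0 := by
    rw [← h_profile, Measure.integral_comp_smul, h0, smul_zero]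
  refine ⟨(integrable_fun_norm_addHaar volume).1 h_int, ?_⟩
  have h_ball : volume.real (ball (0 : E) 1) ≠ 0 :=
    (ENNReal.toReal_pos (measure_ball_pos volume 0 one_pos).ne' measure_ball_lt_top.ne).ne'
  rw [integral_fun_norm_addHaar volume fun t => f (t • x)] at h_zero
  rw [← Nat.cast_smul_eq_nsmul ℝ] at h_zero
  simpa only [smul_eq_zero, Nat.cast_eq_zero, finrank_pos.ne', h_ball, false_or] using h_zero

lemma dilationAverage_eq_neg_integral_Ioi (hrad : ∀ x y, ‖x‖ = ‖y‖ → f x = f y)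
    (hf : Integrable f) (h0 : ∫ x, f x = 0) {x : E} (hx : x ≠ 0) :
    dilationAverage (finrank ℝ E - 1) f x =
      -∫ t : ℝ in Ioi 1, t ^ (finrank ℝ E - 1) • f (t • x) := by
  obtain ⟨h_int, h_zero⟩ := integral_Ioi_pow_smul_of_radial hrad hf h0 hx
  rw [dilationAverage_eq_setIntegral, eq_neg_iff_add_eq_zero,
    ← setIntegral_union (Ioc_disjoint_Ioi le_rfl) measurableSet_Ioi
      (h_int.mono_set Ioc_subset_Ioi_self) (h_int.mono_set (Ioi_subset_Ioi zero_le_one)),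
    Ioc_union_Ioi_eq_Ioi zero_le_one, h_zero]

lemma isBigO_dilationAverage_of_radial (hr : finrank ℝ E < r)
    (hf : SmoothDecay r f) (hrad : ∀ x y, ‖x‖ = ‖y‖ → f x = f y) (h0 : ∫ x, f x = 0) :
    dilationAverage (finrank ℝ E - 1) f =O[⊤] (polyWeight r : E → ℝ) := by
  have hr0 : 0 < r := (Nat.cast_nonneg _).trans_lt hr
  have h_cont : Continuous (dilationAverage (finrank ℝ E - 1) f) := by
    rw [dilationAverage_eq_setIntegral]
    exact ((hf.mono hr0.le).smoothDominated_pow_smul_comp_smul _).contDiff_integral.continuous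
  obtain ⟨C, hC, h_bound⟩ := isBigO_top_polyWeight_iff.1 hf.isBigO
  have h_pred : ((finrank ℝ E - 1 : ℕ) : ℝ) = finrank ℝ E - 1 := Nat.cast_pred finrank_pos
  have h_int : IntegrableOn (fun t : ℝ => t ^ (finrank ℝ E - 1 - r)) (Ioi 1) :=
    integrableOn_Ioi_rpow_of_lt (by linarith) one_pos
  refine isBigO_top_polyWeight_of_cobounded hr0.le h_cont (Asymptotics.IsBigO.of_bound
    (∫ t : ℝ in Ioi 1, C * t ^ (finrank ℝ E - 1 - r)) ?_)
  filter_upwards [eventually_cobounded_le_norm (1 : ℝ)] with x hx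
  have hx0 : 0 < ‖x‖ := by linarith
  rw [dilationAverage_eq_neg_integral_Ioi hrad (hf.integrable hr) h0 (norm_pos_iff.1 hx0), norm_neg,
    Real.norm_of_nonneg (Real.rpow_nonneg hx0.le _), ← integral_mul_const]
  refine norm_integral_le_of_norm_le ((h_int.const_mul C).mul_const _) ?_
  filter_upwards [ae_restrict_mem measurableSet_Ioi] with t ht
  have ht0 : 0 < t := zero_lt_one.trans ht
  have h_le : ‖f (t • x)‖ ≤ C * (t ^ (-r) * ‖x‖ ^ (-r)) := by
    refine (h_bound _).trans (mul_le_mul_of_nonneg_left ?_ hC.le)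
    rw [polyWeight, norm_smul, Real.norm_of_nonneg ht0.le, ← Real.mul_rpow ht0.le hx0.le]
    exact Real.rpow_le_rpow_of_nonpos (mul_pos ht0 hx0) (by linarith) (by linarith)
  rw [norm_smul, norm_pow, Real.norm_of_nonneg ht0.le]
  refine (mul_le_mul_of_nonneg_left h_le (pow_nonneg ht0.le _)).trans_eq ?_
  rw [sub_eq_add_neg _ r, Real.rpow_add ht0, ← h_pred, Real.rpow_natCast]
  ring

lemma smoothDecay_dilationAverage (hr : finrank ℝ E < r) (hr' : r < finrank ℝ E + 1)
    (hf : SmoothDecay r f) (hrad : ∀ x y, ‖x‖ = ‖y‖ → f x = f y) (h0 : ∫ x, f x = 0) :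
    SmoothDecay r (dilationAverage (finrank ℝ E - 1) f) where
  contDiff := by
    have hr0 : 0 ≤ r := (Nat.cast_nonneg _).trans hr.le
    rw [dilationAverage_eq_setIntegral]
    exact ((hf.mono hr0).smoothDominated_pow_smul_comp_smul _).contDiff_integral
  isBigO_iteratedFDeriv n := by
    have hr0 : 0 ≤ r := (Nat.cast_nonneg _).trans hr.le
    rcases n with _ | n
    · refine .of_norm_left ?_
      simp only [norm_iteratedFDeriv_zero]
      exact (isBigO_dilationAverage_of_radial hr hf hrad h0).norm_left
    · have h_pred : finrank ℝ E - 1 + (n + 1) = finrank ℝ E + n := by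
        have := finrank_pos (R := ℝ) (M := E)
        lia
      rw [(hf.mono hr0).iteratedFDeriv_dilationAverage, h_pred]
      refine isBigO_dilationAverage hr0 (hr'.trans_le ?_) (hf.isBigO_iteratedFDeriv _)
      push_cast
      linarith

end RadialDilationAverage

section L1Dilation

variable {E F : Type*} [NormedAddCommGroup E] [NormedSpace ℝ E] [NormedAddCommGroup F]
  [NormedSpace ℝ F] {f : E → F} {r t : ℝ}

/-- The `L¹`-normalized dilation `t^d f(t x)` of `f`. -/
def l1Dilation (t : ℝ) (f : E → F) (x : E) : F := t ^ finrank ℝ E • f (t • x)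

lemma l1Dilation_norm (ht : 0 < t) (f : E → F) :
    l1Dilation t (fun x => ‖f x‖) = fun x => ‖l1Dilation t f x‖ := by
  ext1 x
  rw [l1Dilation, l1Dilation, norm_smul, norm_pow, Real.norm_of_nonneg ht.le, smul_eq_mul]

lemma SmoothDecay.l1Dilation (hf : SmoothDecay r f) (hr : 0 ≤ r) (ht : 0 < t) :
    SmoothDecay r (l1Dilation t f) :=
  hf.const_smul_comp_smul hr _ ht

lemma l1Dilation_dilationAverage [Nontrivial E] [FiniteDimensional ℝ E] (t : ℝ) (f : E → F)
    (x : E) : l1Dilation t (dilationAverage (finrank ℝ E - 1) f) x =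
      ∫ τ in (0 : ℝ)..t, τ ^ (finrank ℝ E - 1) • f (τ • x) := by
  have h_subst := intervalIntegral.smul_integral_comp_mul_left (a := (0 : ℝ)) (b := 1)
    (fun τ : ℝ => τ ^ (finrank ℝ E - 1) • f (τ • x)) t
  rw [mul_zero, mul_one] at h_subst
  rw [← h_subst, l1Dilation, dilationAverage, ← mul_pow_sub_one finrank_pos.ne', mul_smul,
    ← intervalIntegral.integral_smul (t ^ _)]
  simp only [mul_pow, mul_smul, smul_comm t]

lemma exists_norm_rpow_mul_norm_l1Dilation_le (hr : finrank ℝ E ≤ r)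
    (hf : f =O[⊤] (polyWeight r : E → ℝ)) :
    ∃ C, ∀ t, 1 ≤ t → ∀ x, ‖x‖ ^ r * ‖l1Dilation t f x‖ ≤ C := by
  have hr0 : 0 ≤ r := (Nat.cast_nonneg _).trans hr
  obtain ⟨C, hC, h_bound⟩ := isBigO_top_polyWeight_iff.1 hf
  refine ⟨C, fun t ht x => ?_⟩
  have ht0 : 0 < t := one_pos.trans_le ht
  have h_pow : t ^ finrank ℝ E ≤ t ^ r := by
    rw [← Real.rpow_natCast]
    exact Real.rpow_le_rpow_of_exponent_le ht hr
  have h_weight : ‖t • x‖ ^ r * polyWeight r (t • x) ≤ 1 := by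
    rw [← polyWeight_neg_mul (r := r) (t • x), polyWeight_neg]
    gcongr
    · exact (polyWeight_pos _).le
    · linarith
  calc ‖x‖ ^ r * ‖l1Dilation t f x‖ = ‖x‖ ^ r * t ^ finrank ℝ E * ‖f (t • x)‖ := by
        rw [l1Dilation, norm_smul, norm_pow, Real.norm_of_nonneg ht0.le, mul_assoc]
    _ ≤ ‖x‖ ^ r * t ^ r * (C * polyWeight r (t • x)) := by
        gcongr
        exact h_bound _
    _ = C * (‖t • x‖ ^ r * polyWeight r (t • x)) := by
        rw [norm_smul, Real.norm_of_nonneg ht0.le, Real.mul_rpow ht0.le (norm_nonneg x)]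
        ring
    _ ≤ C := mul_le_of_le_one_right hC.le h_weight

variable [FiniteDimensional ℝ E] [MeasureSpace E] [BorelSpace E]
  [(volume : Measure E).IsAddHaarMeasure]

lemma integrable_l1Dilation (hf : Integrable f) (ht : 0 < t) : Integrable (l1Dilation t f) :=
  (hf.comp_smul ht.ne').smul _

lemma integral_l1Dilation (ht : 0 < t) (f : E → F) : ∫ x, l1Dilation t f x = ∫ x, f x := by
  simp only [l1Dilation]
  rw [integral_smul, Measure.integral_comp_smul_of_nonneg volume f t (hR := ht.le),
    smul_inv_smul₀ (pow_pos ht _).ne']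

lemma integral_smul_l1Dilation_sub (ht : 0 < t) (g : E → ℝ) (f : E → F) (y : E) :
    ∫ x, g x • l1Dilation t f (x - y) = ∫ z, g (y + t⁻¹ • z) • f z := by
  rw [← integral_l1Dilation ht fun z => g (y + t⁻¹ • z) • f z,
    ← integral_sub_right_eq_self (l1Dilation t fun z => g (y + t⁻¹ • z) • f z) y]
  congr with x
  rw [l1Dilation, l1Dilation, inv_smul_smul₀ ht.ne', add_sub_cancel, smul_comm]

end L1Dilation

section Telescoping

variable {E F : Type*} [NormedAddCommGroup E] [NormedAddCommGroup F] [NormedSpace ℝ F]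
  {f : E → F} {r : ℝ} {g u : E → ℝ} [MeasureSpace E] [BorelSpace E] [SecondCountableTopology E]

lemma integrable_smul_comp_sub (hr : 0 ≤ r) (hu : WeightIntegrable r u) (hf : Continuous f)
    (hfr : f =O[⊤] (polyWeight r : E → ℝ)) (x : E) : Integrable fun y => u y • f (x - y) := by
  refine hu.integrable_smul (by fun_prop : Continuous fun y => f (x - y)).aestronglyMeasurable ?_
  obtain ⟨C, hC, h_bound⟩ := isBigO_top_polyWeight_iff.1 hfr
  refine Asymptotics.isBigO_top.2 ⟨C * (1 + ‖x‖) ^ r, fun y => (h_bound _).trans ?_⟩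
  rw [norm_polyWeight, mul_assoc]
  gcongr
  exact polyWeight_sub_le hr x y

lemma integral_smul_comp_sub_eq_sum {ι : Type*} [Fintype ι] {w : ι → E → ℝ} (hr : 0 ≤ r)
    (hw : ∀ i, WeightIntegrable r (w i)) (hu : u =ᵐ[volume] fun y => ∑ i, w i y)
    (hf : Continuous f) (hfr : f =O[⊤] (polyWeight r : E → ℝ)) (x : E) :
    ∫ y, u y • f (x - y) = ∑ i, ∫ y, w i y • f (x - y) := by
  rw [← integral_finsetSum _ fun i _ => integrable_smul_comp_sub hr (hw i) hf hfr x]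
  refine integral_congr_ae ?_
  filter_upwards [hu] with y hy
  rw [hy, Finset.sum_smul]

lemma integrable_uncurry_smul_smul_comp_sub (hr : 0 ≤ r)
    (hg : WeightIntegrable (-r) g) (hu : WeightIntegrable r u) (hf : Continuous f)
    (hfr : f =O[⊤] (polyWeight r : E → ℝ)) :
    Integrable (Function.uncurry fun x y => g x • u y • f (x - y)) (volume.prod volume) := by
  obtain ⟨C, hC, h_bound⟩ := isBigO_top_polyWeight_iff.1 hfr
  refine (((Integrable.norm hg).mul_prod (Integrable.norm hu)).const_mul C).mono' ?_ ?_
  · exact hg.aestronglyMeasurable.comp_fst.smul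
      (hu.aestronglyMeasurable.comp_snd.smul (Continuous.aestronglyMeasurable (by fun_prop)))
  filter_upwards with ⟨x, y⟩
  simp only [Function.uncurry, norm_smul, norm_mul, norm_polyWeight]
  calc ‖g x‖ * (‖u y‖ * ‖f (x - y)‖)
      ≤ ‖g x‖ * (‖u y‖ * (C * ((1 + ‖x‖) ^ r * polyWeight r y))) := by
        gcongr
        exact (h_bound _).trans (mul_le_mul_of_nonneg_left (polyWeight_sub_le hr x y) hC.le)
    _ = C * (polyWeight (-r) x * ‖g x‖ * (polyWeight r y * ‖u y‖)) := by
        rw [polyWeight_neg]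
        ring

variable [NormedSpace ℝ E]

lemma integrable_uncurry_pow_smul_smul_comp_smul_sub [SFinite (volume : Measure E)] (hr : 0 ≤ r)
    (hu : WeightIntegrable r u) (hf : Continuous f) (hfr : f =O[⊤] (polyWeight r : E → ℝ)) (k : ℕ)
    {a b : ℝ} (ha : 0 < a) (hab : a ≤ b) (x : E) :
    Integrable (Function.uncurry fun (t : ℝ) y => t ^ k • u y • f (t • (x - y)))
      ((volume.restrict (uIoc a b)).prod volume) := by
  have hc : 0 < min 1 a := lt_min one_pos ha
  obtain ⟨C, hC, h_bound⟩ := isBigO_top_polyWeight_iff.1 hfr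
  rw [uIoc_of_le hab]
  refine ((Integrable.comp_snd hu (volume.restrict (Ioc a b))).norm.const_mul
    (b ^ k * (C * ((min 1 a)⁻¹ ^ r * (1 + ‖x‖) ^ r)))).mono' ?_ ?_
  · exact (Continuous.aestronglyMeasurable (by fun_prop)).smul
      (hu.aestronglyMeasurable.comp_snd.smul (Continuous.aestronglyMeasurable (by fun_prop)))
  filter_upwards [Measure.quasiMeasurePreserving_fst.ae (ae_restrict_mem measurableSet_Ioc)]
    with ⟨t, y⟩ ht
  have ht0 : 0 < t := ha.trans ht.1
  have h_weight : polyWeight r (t • (x - y)) ≤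
      (min 1 a)⁻¹ ^ r * ((1 + ‖x‖) ^ r * polyWeight r y) :=
    (polyWeight_smul_le hr hc (min_le_left _ _) ((min_le_right _ _).trans ht.1.le) _).trans
      (mul_le_mul_of_nonneg_left (polyWeight_sub_le hr x y) (by positivity))
  simp only [Function.uncurry, norm_smul, norm_mul, norm_polyWeight, norm_pow,
    Real.norm_of_nonneg ht0.le]
  calc t ^ k * (‖u y‖ * ‖f (t • (x - y))‖)
      ≤ b ^ k * (‖u y‖ * (C * ((min 1 a)⁻¹ ^ r * ((1 + ‖x‖) ^ r * polyWeight r y)))) := by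
        gcongr
        · exact pow_nonneg (ht0.le.trans ht.2) k
        · exact ht.2
        · exact (h_bound _).trans (by gcongr)
    _ = b ^ k * (C * ((min 1 a)⁻¹ ^ r * (1 + ‖x‖) ^ r)) * (polyWeight r y * ‖u y‖) := by ring

lemma integral_smul_l1Dilation_dilationAverage_sub [FiniteDimensional ℝ E] [Nontrivial E]
    [SFinite (volume : Measure E)] (hr : 0 ≤ r) (hu : WeightIntegrable r u) (hf : SmoothDecay r f)
    (hρ : SmoothDecay r (dilationAverage (finrank ℝ E - 1) f)) {a b : ℝ} (ha : 0 < a)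
    (hab : a ≤ b) (x : E) :
    (∫ y, u y • l1Dilation b (dilationAverage (finrank ℝ E - 1) f) (x - y)) -
        ∫ y, u y • l1Dilation a (dilationAverage (finrank ℝ E - 1) f) (x - y) =
      ∫ t in a..b, t ^ (finrank ℝ E - 1) • ∫ y, u y • f (t • (x - y)) := by
  have hf_cont := hf.contDiff.continuous
  have h_int {t : ℝ} (ht : 0 < t) : Integrable fun y =>
      u y • l1Dilation t (dilationAverage (finrank ℝ E - 1) f) (x - y) :=
    have h := hρ.l1Dilation hr ht
    integrable_smul_comp_sub hr hu h.contDiff.continuous h.isBigO x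
  have h_cont (y : E) : Continuous fun t : ℝ => t ^ (finrank ℝ E - 1) • f (t • (x - y)) := by
    fun_prop
  rw [← integral_sub (h_int (ha.trans_le hab)) (h_int ha)]
  simp only [← integral_smul]
  rw [intervalIntegral_integral_swap (integrable_uncurry_pow_smul_smul_comp_smul_sub hr hu hf_cont
    hf.isBigO _ ha hab x)]
  congr with y
  simp only [smul_comm _ (u y)]
  rw [intervalIntegral.integral_smul, ← smul_sub, l1Dilation_dilationAverage,
    l1Dilation_dilationAverage, intervalIntegral.integral_interval_sub_left]
  · exact (h_cont y).intervalIntegrable _ _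
  · exact (h_cont y).intervalIntegrable _ _

end Telescoping

section ApproximateIdentity

lemma one_add_norm_rpow_le {E : Type*} [NormedAddCommGroup E] {r : ℝ} (hr : 0 ≤ r) (x y : E) :
    (1 + ‖y‖) ^ r ≤ 2 ^ r * ((1 + ‖x‖) ^ r + ‖x - y‖ ^ r) := by
  have h_tri : 1 + ‖y‖ ≤ (1 + ‖x‖) + ‖x - y‖ := by linarith [norm_le_norm_add_norm_sub x y]
  rcases le_total (1 + ‖x‖) ‖x - y‖ with h | h
  · calc (1 + ‖y‖) ^ r ≤ (2 * ‖x - y‖) ^ r := by gcongr; linarith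
      _ = 2 ^ r * ‖x - y‖ ^ r := Real.mul_rpow zero_le_two (norm_nonneg _)
      _ ≤ _ := by gcongr; exact le_add_of_nonneg_left (by positivity)
  · calc (1 + ‖y‖) ^ r ≤ (2 * (1 + ‖x‖)) ^ r := by gcongr; linarith
      _ = 2 ^ r * (1 + ‖x‖) ^ r := Real.mul_rpow zero_le_two (by positivity)
      _ ≤ _ := by gcongr; exact le_add_of_nonneg_right (by positivity)

variable {E F : Type*} [NormedAddCommGroup E] [NormedSpace ℝ E] [FiniteDimensional ℝ E]
  [MeasureSpace E] [BorelSpace E] [(volume : Measure E).IsAddHaarMeasure]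
  [NormedAddCommGroup F] [NormedSpace ℝ F] {f : E → F} {g u : E → ℝ} {r : ℝ}

lemma exists_norm_integral_smul_l1Dilation_sub_le (hr : finrank ℝ E ≤ r) (hg : Integrable g)
    (hgr : g =O[⊤] (polyWeight r : E → ℝ)) (hf : Integrable f)
    (hfr : f =O[⊤] (polyWeight r : E → ℝ)) :
    ∃ C, ∀ t, 1 ≤ t → ∀ y, ‖∫ x, g x • l1Dilation t f (x - y)‖ ≤ C * polyWeight r y := by
  obtain ⟨A, -, hgA⟩ := isBigO_top_polyWeight_iff.1 hgr
  obtain ⟨B, hfB⟩ := exists_norm_rpow_mul_norm_l1Dilation_le hr hfr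
  refine ⟨2 ^ r * (A * (∫ x, ‖f x‖) + B * ∫ x, ‖g x‖), fun t ht y => ?_⟩
  have hr0 : 0 ≤ r := (Nat.cast_nonneg _).trans hr
  have ht0 : 0 < t := one_pos.trans_le ht
  have hf_int : Integrable fun x => ‖l1Dilation t f (x - y)‖ :=
    ((integrable_l1Dilation hf ht0).comp_sub_right y).norm
  have hf_norm : ∫ x, ‖l1Dilation t f (x - y)‖ = ∫ x, ‖f x‖ := by
    rw [integral_sub_right_eq_self fun x => ‖l1Dilation t f x‖, ← l1Dilation_norm ht0,
      integral_l1Dilation ht0]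
  rw [← hf_norm, ← integral_const_mul, ← integral_const_mul,
    ← integral_add (hf_int.const_mul A) (hg.norm.const_mul B), mul_right_comm,
    ← integral_const_mul]
  refine norm_integral_le_of_norm_le (((hf_int.const_mul A).add (hg.norm.const_mul B)).const_mul _)
    (Eventually.of_forall fun x => ?_)
  have h_one : 1 ≤ 2 ^ r * polyWeight r y * ((1 + ‖x‖) ^ r + ‖x - y‖ ^ r) := by
    have h := mul_le_mul_of_nonneg_right (one_add_norm_rpow_le hr0 x y)
      (polyWeight_pos (r := r) y).le
    rwa [← polyWeight_neg, polyWeight_neg_mul, mul_right_comm] at h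
  have hg_weight : (1 + ‖x‖) ^ r * ‖g x‖ ≤ A := by
    calc (1 + ‖x‖) ^ r * ‖g x‖ ≤ polyWeight (-r) x * (A * polyWeight r x) := by
          rw [polyWeight_neg]
          gcongr
          exact hgA x
      _ = A := by rw [mul_left_comm, polyWeight_neg_mul, mul_one]
  rw [norm_smul]
  calc ‖g x‖ * ‖l1Dilation t f (x - y)‖
      ≤ 2 ^ r * polyWeight r y * ((1 + ‖x‖) ^ r + ‖x - y‖ ^ r) *
          (‖g x‖ * ‖l1Dilation t f (x - y)‖) := le_mul_of_one_le_left (by positivity) h_one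
    _ = 2 ^ r * polyWeight r y * ((1 + ‖x‖) ^ r * ‖g x‖ * ‖l1Dilation t f (x - y)‖ +
          ‖x - y‖ ^ r * ‖l1Dilation t f (x - y)‖ * ‖g x‖) := by ring
    _ ≤ _ := by
        have := polyWeight_pos (r := r) y
        gcongr
        exact hfB t ht _

lemma tendsto_integral_smul_l1Dilation_sub (hg : Continuous g) (hgb : ∃ C, ∀ x, ‖g x‖ ≤ C)
    (hf : Integrable f) (y : E) :
    Tendsto (fun t : ℝ => ∫ x, g x • l1Dilation t f (x - y)) atTop (𝓝 (g y • ∫ x, f x)) := by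
  obtain ⟨C, hC⟩ := hgb
  rw [← integral_smul]
  refine Tendsto.congr' (f₁ := fun t : ℝ => ∫ z, g (y + t⁻¹ • z) • f z) ?_ ?_
  · filter_upwards [eventually_gt_atTop 0] with t ht
    rw [integral_smul_l1Dilation_sub ht]
  refine tendsto_integral_filter_of_dominated_convergence (fun z => C * ‖f z‖)
    (Eventually.of_forall fun t => ?_) (Eventually.of_forall fun t => Eventually.of_forall fun z =>
      ?_) (hf.norm.const_mul C) (Eventually.of_forall fun z => ?_)
  · exact (by fun_prop : Continuous fun z => g (y + t⁻¹ • z)).aestronglyMeasurable.smul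
      hf.aestronglyMeasurable
  · rw [norm_smul]
    exact mul_le_mul_of_nonneg_right (hC _) (norm_nonneg _)
  · have h_arg : Tendsto (fun t : ℝ => y + t⁻¹ • z) atTop (𝓝 y) := by
      simpa only [zero_smul, add_zero] using
        ((tendsto_inv_atTop_zero (𝕜 := ℝ)).smul_const z).const_add y
    exact ((hg.tendsto y).comp h_arg).smul_const (f z)

lemma tendsto_integral_smul_integral_smul_l1Dilation_sub (hr : finrank ℝ E < r)
    (hg : Continuous g) (hgc : HasCompactSupport g) (hu : WeightIntegrable r u)
    (hf : SmoothDecay r f) :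
    Tendsto (fun t : ℝ => ∫ x, g x • ∫ y, u y • l1Dilation t f (x - y)) atTop
      (𝓝 (∫ y, u y • g y • ∫ x, f x)) := by
  have hr0 : 0 ≤ r := (Nat.cast_nonneg _).trans hr.le
  have hf_int := hf.integrable hr
  have hg_int := hg.integrable_of_hasCompactSupport (μ := volume) hgc
  have hg_weight : WeightIntegrable (-r) g :=
    (continuous_polyWeight.mul hg).integrable_of_hasCompactSupport hgc.mul_left
  have hgr : g =O[⊤] (polyWeight r : E → ℝ) := by
    refine isBigO_top_polyWeight_of_cobounded hr0 hg ?_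
    refine (Asymptotics.isBigO_zero _ _).congr' ?_ EventuallyEq.rfl
    rw [cobounded_eq_cocompact, ← coclosedCompact_eq_cocompact]
    exact (hasCompactSupport_iff_eventuallyEq.1 hgc).symm
  obtain ⟨C, hC⟩ := exists_norm_integral_smul_l1Dilation_sub_le hr.le hg_int hgr hf_int hf.isBigO
  have h_swap {t : ℝ} (ht : 0 < t) : ∫ x, g x • ∫ y, u y • l1Dilation t f (x - y) =
      ∫ y, u y • ∫ x, g x • l1Dilation t f (x - y) := by
    have h := hf.l1Dilation hr0 ht
    simp only [← integral_smul]
    rw [integral_integral_swap (integrable_uncurry_smul_smul_comp_sub hr0 hg_weight hu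
      h.contDiff.continuous h.isBigO)]
    simp only [smul_comm (g _)]
  refine Tendsto.congr' (f₁ := fun t : ℝ => ∫ y, u y • ∫ x, g x • l1Dilation t f (x - y)) ?_ ?_
  · filter_upwards [eventually_gt_atTop 0] with t ht using (h_swap ht).symm
  refine tendsto_integral_filter_of_dominated_convergence (fun y => C * ‖polyWeight r y * u y‖)
    ?_ ?_ (hu.norm.const_mul C) (Eventually.of_forall fun y =>
      (tendsto_integral_smul_l1Dilation_sub hg (hg.bounded_above_of_compact_support hgc) hf_int
        y).const_smul (u y))
  · filter_upwards with t
    have hf_cont := hf.contDiff.continuous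
    refine hu.aestronglyMeasurable.smul (AEStronglyMeasurable.integral_prod_right'
      (f := fun z : E × E => g z.2 • l1Dilation t f (z.2 - z.1)) ?_)
    simp only [l1Dilation]
    exact Continuous.aestronglyMeasurable (by fun_prop)
  · filter_upwards [eventually_ge_atTop 1] with t ht
    filter_upwards with y
    rw [norm_smul, norm_mul, norm_polyWeight, mul_comm (polyWeight r y), mul_left_comm]
    exact mul_le_mul_of_nonneg_left (hC t ht y) (norm_nonneg _)

end ApproximateIdentity

section CosineTransform

variable {E : Type*} [NormedAddCommGroup E] [InnerProductSpace ℝ E] [FiniteDimensional ℝ E]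
  [MeasurableSpace E] [BorelSpace E] {f : E → ℝ} {r t : ℝ}

/-- The cosine transform `∫ cos (2π⟪ξ, y⟫) f(y) dy`, i.e. the real part of the Fourier transform
of a real-valued integrable function. -/
def cosTransform (f : E → ℝ) (ξ : E) : ℝ := ∫ y, Real.cos (2 * Real.pi * inner ℝ ξ y) • f y

lemma integrable_cos_smul (hf : Integrable f) (ξ : E) :
    Integrable fun y => Real.cos (2 * Real.pi * inner ℝ ξ y) • f y :=
  hf.bdd_smul 1
    (by fun_prop : Continuous fun y => Real.cos (2 * Real.pi * inner ℝ ξ y)).aestronglyMeasurable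
    (Eventually.of_forall fun _ => Real.abs_cos_le_one _)

lemma integrable_fourierChar_smul_ofReal (hf : Integrable f) (ξ : E) :
    Integrable fun y => 𝐞 (-inner ℝ y ξ) • (f y : ℂ) :=
  (Real.fourierIntegral_convergent_iff ξ).2 hf.ofReal

lemma cosTransform_eq_re_fourier (hf : Integrable f) (ξ : E) :
    cosTransform f ξ = (𝓕 (fun x => (f x : ℂ)) ξ).re := by
  rw [cosTransform, Real.fourier_eq, ← RCLike.re_eq_complex_re,
    ← integral_re (integrable_fourierChar_smul_ofReal hf ξ)]
  congr 1 with y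
  rw [RCLike.re_eq_complex_re, Circle.smul_def, smul_eq_mul, smul_eq_mul, Complex.re_mul_ofReal,
    Real.fourierChar_apply, Complex.exp_ofReal_mul_I_re, mul_neg, Real.cos_neg, real_inner_comm]

lemma fourier_eq_cosTransform_of_even (hf : Integrable f) (h_even : ∀ x, f (-x) = f x) (ξ : E) :
    𝓕 (fun x => (f x : ℂ)) ξ = cosTransform f ξ := by
  refine Complex.ext (cosTransform_eq_re_fourier hf ξ).symm ?_
  have h_im : (𝓕 (fun x => (f x : ℂ)) ξ).im =
      ∫ y, Real.sin (2 * Real.pi * -inner ℝ y ξ) * f y := by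
    rw [Real.fourier_eq, ← RCLike.im_eq_complex_im,
      ← integral_im (integrable_fourierChar_smul_ofReal hf ξ)]
    congr 1 with y
    rw [RCLike.im_eq_complex_im, Circle.smul_def, smul_eq_mul, Complex.im_mul_ofReal,
      Real.fourierChar_apply, Complex.exp_ofReal_mul_I_im]
  have h_odd := integral_neg_eq_self (fun y => Real.sin (2 * Real.pi * -inner ℝ y ξ) * f y) volume
  simp only [h_even, inner_neg_left, mul_neg, Real.sin_neg, neg_mul, neg_neg, integral_neg]
    at h_odd h_im
  rw [h_im, Complex.ofReal_im]
  linarith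

lemma cosTransform_zero (f : E → ℝ) : cosTransform f 0 = ∫ x, f x := by
  simp only [cosTransform, inner_zero_left, mul_zero, Real.cos_zero, one_smul]

lemma continuous_cosTransform (hf : Integrable f) : Continuous (cosTransform f) := by
  refine continuous_of_dominated (fun ξ => (integrable_cos_smul hf ξ).aestronglyMeasurable)
    (fun ξ => Eventually.of_forall fun y => ?_) hf.norm (Eventually.of_forall fun y => by fun_prop)
  rw [norm_smul]
  exact mul_le_of_le_one_left (norm_nonneg _) (Real.abs_cos_le_one _)

lemma tendsto_cosTransform_cocompact (hf : Integrable f) :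
    Tendsto (cosTransform f) (cocompact E) (𝓝 0) := by
  rw [funext (cosTransform_eq_re_fourier hf), ← Complex.zero_re]
  exact (Complex.continuous_re.tendsto 0).comp
    (tendsto_integral_exp_inner_smul_cocompact fun x => (f x : ℂ))

lemma cosTransform_l1Dilation (ht : 0 < t) (f : E → ℝ) (ξ : E) :
    cosTransform (l1Dilation t f) ξ = cosTransform f (t⁻¹ • ξ) := by
  have h := integral_smul_l1Dilation_sub ht (fun y => Real.cos (2 * Real.pi * inner ℝ ξ y)) f 0
  simp only [sub_zero, zero_add] at h
  simp only [cosTransform, h, real_inner_smul_left, real_inner_smul_right]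

lemma integral_cos_smul_comp_zero_sub (f : E → ℝ) (ξ : E) :
    ∫ y, Real.cos (2 * Real.pi * inner ℝ ξ y) • f (0 - y) = cosTransform f ξ := by
  rw [cosTransform, ← integral_sub_left_eq_self _ volume 0]
  simp only [zero_sub, inner_neg_right, mul_neg, Real.cos_neg, neg_neg]

lemma cosTransform_dilationAverage_sub [Nontrivial E] (hr : finrank ℝ E < r)
    (hf : SmoothDecay r f) (hρ : SmoothDecay r (dilationAverage (finrank ℝ E - 1) f)) {a b : ℝ}
    (ha : 0 < a) (hab : a ≤ b) (ξ : E) :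
    cosTransform (dilationAverage (finrank ℝ E - 1) f) (b⁻¹ • ξ) -
        cosTransform (dilationAverage (finrank ℝ E - 1) f) (a⁻¹ • ξ) =
      ∫ t in a..b, t⁻¹ * cosTransform f (t⁻¹ • ξ) := by
  have h_cos : WeightIntegrable r fun y => Real.cos (2 * Real.pi * inner ℝ ξ y) :=
    .of_memLp (p := ⊤) hr le_top (memLp_top_of_bound (Continuous.aestronglyMeasurable
      (by fun_prop)) 1 (Eventually.of_forall fun _ => Real.abs_cos_le_one _))
  rw [← cosTransform_l1Dilation ha, ← cosTransform_l1Dilation (ha.trans_le hab),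
    ← integral_cos_smul_comp_zero_sub, ← integral_cos_smul_comp_zero_sub,
    integral_smul_l1Dilation_dilationAverage_sub ((Nat.cast_nonneg _).trans hr.le) h_cos hf hρ ha
      hab]
  refine intervalIntegral.integral_congr fun t ht => ?_
  have ht0 : 0 < t := ha.trans_le (uIcc_of_le hab ▸ ht).1
  have h_pow : t ^ (finrank ℝ E - 1) = t⁻¹ * t ^ finrank ℝ E := by
    rw [← mul_pow_sub_one finrank_pos.ne', inv_mul_cancel_left₀ ht0.ne']
  simp only [← cosTransform_l1Dilation ht0, ← integral_cos_smul_comp_zero_sub, l1Dilation]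
  rw [h_pow, mul_smul, ← integral_smul, smul_eq_mul]
  simp only [smul_comm (t ^ _)]

lemma integral_dilationAverage_pos [Nontrivial E] (hr : finrank ℝ E < r) (hf : SmoothDecay r f)
    (hρ : SmoothDecay r (dilationAverage (finrank ℝ E - 1) f))
    (h_nonneg : ∀ ξ, 0 ≤ cosTransform f ξ) (h_pos : ∃ ξ ≠ 0, 0 < cosTransform f ξ) :
    0 < ∫ x, dilationAverage (finrank ℝ E - 1) f x := by
  obtain ⟨ξ, hξ, h_pos⟩ := h_pos
  have hρ_int := hρ.integrable hr
  set q : ℝ → ℝ := fun t => cosTransform (dilationAverage (finrank ℝ E - 1) f) (t⁻¹ • ξ)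
  have h_sub {a b : ℝ} (ha : 0 < a) (hab : a ≤ b) :
      q b - q a = ∫ t in a..b, t⁻¹ * cosTransform f (t⁻¹ • ξ) :=
    cosTransform_dilationAverage_sub hr hf hρ ha hab ξ
  have h_integrand {t : ℝ} (ht : 0 < t) : 0 ≤ t⁻¹ * cosTransform f (t⁻¹ • ξ) :=
    mul_nonneg (inv_nonneg.2 ht.le) (h_nonneg _)
  have h_mono {a b : ℝ} (ha : 0 < a) (hab : a ≤ b) : q a ≤ q b := by
    rw [← sub_nonneg, h_sub ha hab]
    exact intervalIntegral.integral_nonneg hab fun t ht => h_integrand (ha.trans_le ht.1)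
  have h_zero : Tendsto q (𝓝[>] 0) (𝓝 0) := by
    refine (tendsto_cosTransform_cocompact hρ_int).comp ?_
    rw [← cobounded_eq_cocompact, ← tendsto_norm_atTop_iff_cobounded]
    simp only [norm_smul]
    exact (tendsto_norm_atTop_atTop.comp tendsto_inv_nhdsGT_zero).atTop_mul_const
      (norm_pos_iff.2 hξ)
  have h_top : Tendsto q atTop (𝓝 (∫ x, dilationAverage (finrank ℝ E - 1) f x)) := by
    have h_arg : Tendsto (fun t : ℝ => t⁻¹ • ξ) atTop (𝓝 0) := by
      simpa only [zero_smul] using (tendsto_inv_atTop_zero (𝕜 := ℝ)).smul_const ξ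
    rw [← cosTransform_zero]
    exact ((continuous_cosTransform hρ_int).tendsto 0).comp h_arg
  have h_cont : ContinuousOn (fun t : ℝ => t⁻¹ * cosTransform f (t⁻¹ • ξ)) (Icc 1 2) := by
    have h_inv : ContinuousOn (fun t : ℝ => t⁻¹) (Icc 1 2) :=
      continuousOn_inv₀.mono fun t ht => (one_pos.trans_le ht.1).ne'
    exact h_inv.mul ((continuous_cosTransform (hf.integrable hr)).comp_continuousOn
      (h_inv.smul continuousOn_const))
  calc 0 ≤ q 1 := le_of_tendsto h_zero <| by
        filter_upwards [Ioc_mem_nhdsGT one_pos] with t ht using h_mono ht.1 ht.2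
    _ < q 2 := by
        rw [← sub_pos, h_sub one_pos one_le_two]
        refine intervalIntegral.integral_pos one_lt_two h_cont
          (fun t ht => h_integrand (one_pos.trans ht.1)) ⟨1, ⟨le_rfl, one_le_two⟩, ?_⟩
        rwa [inv_one, one_smul, one_mul]
    _ ≤ _ := ge_of_tendsto h_top <| by
        filter_upwards [eventually_ge_atTop 2] with t ht using h_mono two_pos ht

end CosineTransform

section RadialBump

variable {E : Type*} [NormedAddCommGroup E]

/-- A smooth radial bump function supported in the ball of radius `1/2`. -/
def radialBump (x : E) : ℝ := Real.smoothTransition (1 - 4 * ‖x‖ ^ 2)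

lemma radialBump_eq_zero {x : E} (hx : 1 / 2 ≤ ‖x‖) : radialBump x = 0 :=
  Real.smoothTransition.zero_of_nonpos (by nlinarith)

variable [InnerProductSpace ℝ E]

lemma contDiff_radialBump : ContDiff ℝ ∞ (radialBump : E → ℝ) :=
  Real.smoothTransition.contDiff.comp
    (contDiff_const.sub (contDiff_const.mul (contDiff_norm_sq ℝ)))

variable [FiniteDimensional ℝ E]

lemma hasCompactSupport_radialBump : HasCompactSupport (radialBump : E → ℝ) := by
  refine HasCompactSupport.intro (isCompact_closedBall 0 (1 / 2)) fun x hx => ?_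
  rw [mem_closedBall_zero_iff, not_le] at hx
  exact radialBump_eq_zero hx.le

variable [MeasurableSpace E] [BorelSpace E]

lemma integrable_radialBump : Integrable (radialBump : E → ℝ) :=
  contDiff_radialBump.continuous.integrable_of_hasCompactSupport hasCompactSupport_radialBump

lemma integral_radialBump_pos : 0 < ∫ x : E, radialBump x :=
  contDiff_radialBump.continuous.integral_pos_of_hasCompactSupport_nonneg_nonzero
    hasCompactSupport_radialBump (fun _ => Real.smoothTransition.nonneg _) (x := 0)
    (by simp [radialBump])

/-- The autocorrelation of `radialBump`. It is a radial test function supported in the unit ball,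
and, unlike `radialBump` itself, it has a nonnegative Fourier transform. -/
def bumpAutocorrelation : E → ℝ :=
  convolution radialBump radialBump (ContinuousLinearMap.mul ℝ ℝ) volume

lemma bumpAutocorrelation_apply (x : E) :
    bumpAutocorrelation x = ∫ y, radialBump y * radialBump (x - y) := rfl

lemma contDiff_bumpAutocorrelation : ContDiff ℝ ∞ (bumpAutocorrelation : E → ℝ) :=
  hasCompactSupport_radialBump.contDiff_convolution_right _
    contDiff_radialBump.continuous.locallyIntegrable contDiff_radialBump

lemma hasCompactSupport_bumpAutocorrelation : HasCompactSupport (bumpAutocorrelation : E → ℝ) :=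
  hasCompactSupport_radialBump.convolution _ hasCompactSupport_radialBump

lemma bumpAutocorrelation_comp_linearIsometryEquiv (A : E ≃ₗᵢ[ℝ] E) (x : E) :
    bumpAutocorrelation (A x) = bumpAutocorrelation x := by
  rw [bumpAutocorrelation_apply, bumpAutocorrelation_apply,
    ← A.measurePreserving.integral_comp A.toHomeomorph.measurableEmbedding]
  simp only [← map_sub, radialBump, LinearIsometryEquiv.norm_map]

lemma bumpAutocorrelation_eq_zero {x : E} (hx : 1 ≤ ‖x‖) : bumpAutocorrelation x = 0 := by
  rw [bumpAutocorrelation_apply, ← integral_zero E ℝ]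
  congr 1 with y
  rcases le_total (1 / 2) ‖y‖ with h | h
  · rw [radialBump_eq_zero h, zero_mul]
  · rw [radialBump_eq_zero (x := x - y), mul_zero]
    linarith [norm_sub_norm_le x y]

lemma integrable_bumpAutocorrelation : Integrable (bumpAutocorrelation : E → ℝ) :=
  contDiff_bumpAutocorrelation.continuous.integrable_of_hasCompactSupport
    hasCompactSupport_bumpAutocorrelation

lemma cosTransform_bumpAutocorrelation (ξ : E) :
    cosTransform bumpAutocorrelation ξ = cosTransform radialBump ξ ^ 2 := by
  have h_bump : Integrable fun x : E => (radialBump x : ℂ) := integrable_radialBump.ofReal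
  have h_conv : (fun x : E => (bumpAutocorrelation x : ℂ)) = convolution
      (fun x => (radialBump x : ℂ)) (fun x => (radialBump x : ℂ)) (ContinuousLinearMap.mul ℂ ℂ)
      volume := by
    ext x
    simp only [bumpAutocorrelation_apply, ← integral_complex_ofReal, convolution,
      Complex.ofReal_mul, ContinuousLinearMap.mul_apply']
  rw [cosTransform_eq_re_fourier integrable_bumpAutocorrelation, h_conv,
    Real.fourier_mul_convolution_eq h_bump h_bump,
    fourier_eq_cosTransform_of_even integrable_radialBump fun x => by rw [radialBump, norm_neg,
      radialBump], ← Complex.ofReal_mul, Complex.ofReal_re, sq]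

lemma exists_cosTransform_bumpAutocorrelation_pos [Nontrivial E] :
    ∃ ξ : E, ξ ≠ 0 ∧ 0 < cosTransform bumpAutocorrelation ξ := by
  have h_zero : 0 < cosTransform (bumpAutocorrelation : E → ℝ) 0 := by
    rw [cosTransform_bumpAutocorrelation, cosTransform_zero]
    exact pow_pos integral_radialBump_pos 2
  have h_nhds := ((continuous_cosTransform integrable_bumpAutocorrelation).tendsto
    (0 : E)).eventually_const_lt h_zero
  have h_ne : ∀ᶠ ξ in 𝓝[≠] (0 : E), ξ ≠ 0 := eventually_mem_nhdsWithin
  exact (h_ne.and (h_nhds.filter_mono nhdsWithin_le_nhds)).exists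

end RadialBump

section Parametrix

variable {E : Type*} [NormedAddCommGroup E] [InnerProductSpace ℝ E] [FiniteDimensional ℝ E]
  [MeasurableSpace E] [BorelSpace E] {s : ℝ} {m : ℕ}

/-- The kernel `∫₀¹ λ^{d-1} (Λ η)(λ x) dλ`, where `Λ` is the hypersingular integral of order `2s`
and `η` is `bumpAutocorrelation`. Its `L¹`-normalized dilations at scale `t` have `t`-derivative
`t^{d-1} (Λ η)(t x)`, which an `s`-harmonic function does not see. -/
def parametrix (s : ℝ) (m : ℕ) : E → ℝ :=
  dilationAverage (finrank ℝ E - 1) (hypersingular s m bumpAutocorrelation)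

lemma hypersingular_bumpAutocorrelation_radial (s : ℝ) (m : ℕ) (x y : E) (h : ‖x‖ = ‖y‖) :
    hypersingular s m bumpAutocorrelation x = hypersingular s m bumpAutocorrelation y := by
  obtain ⟨A, rfl⟩ := exists_linearIsometryEquiv_apply_eq h
  rw [← hypersingular_comp_linearIsometryEquiv]
  simp only [bumpAutocorrelation_comp_linearIsometryEquiv]

variable [Nontrivial E] {r : ℝ}

lemma smoothDecay_hypersingular_bumpAutocorrelation (hs : 0 < s) (hm : s < m) :
    SmoothDecay (finrank ℝ E + 2 * s) (hypersingular s m (bumpAutocorrelation : E → ℝ)) :=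
  smoothDecay_hypersingular contDiff_bumpAutocorrelation hasCompactSupport_bumpAutocorrelation hs hm

lemma smoothDecay_parametrix (hs : 0 < s) (hm : s < m) (hr : finrank ℝ E < r)
    (hr' : r < finrank ℝ E + 1) (hrs : r ≤ finrank ℝ E + 2 * s) :
    SmoothDecay r (parametrix s m : E → ℝ) :=
  smoothDecay_dilationAverage hr hr'
    ((smoothDecay_hypersingular_bumpAutocorrelation hs hm).mono hrs)
    (hypersingular_bumpAutocorrelation_radial s m)
    (integral_hypersingular_eq_zero contDiff_bumpAutocorrelation
      hasCompactSupport_bumpAutocorrelation hs hm)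

lemma cosTransform_hypersingular {f : E → ℝ} (hf : ContDiff ℝ ∞ f) (hfc : HasCompactSupport f)
    (hs : 0 < s) (hm : s < m) (ξ : E) :
    cosTransform (hypersingular s m f) ξ = hyperSymbol s m ξ * cosTransform f ξ := by
  rw [cosTransform_eq_re_fourier (integrable_hypersingular hf hfc hs hm),
    cosTransform_eq_re_fourier (hf.continuous.integrable_of_hasCompactSupport hfc),
    fourier_hypersingular hf hfc hs hm, Complex.smul_re, smul_eq_mul]

lemma integral_parametrix_pos (hs : 0 < s) (hm : s < m) (hr : finrank ℝ E < r)
    (hr' : r < finrank ℝ E + 1) (hrs : r ≤ finrank ℝ E + 2 * s) :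
    0 < ∫ x : E, parametrix s m x := by
  have h_transform (ξ : E) : cosTransform (hypersingular s m bumpAutocorrelation) ξ =
      hyperSymbol s m ξ * cosTransform radialBump ξ ^ 2 := by
    rw [cosTransform_hypersingular contDiff_bumpAutocorrelation
      hasCompactSupport_bumpAutocorrelation hs hm, cosTransform_bumpAutocorrelation]
  refine integral_dilationAverage_pos hr
    ((smoothDecay_hypersingular_bumpAutocorrelation hs hm).mono hrs)
    (smoothDecay_parametrix hs hm hr hr' hrs) (fun ξ => ?_) ?_
  · obtain ⟨κ, hκ, h_symbol⟩ := exists_hyperSymbol_eq (E := E) hs hm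
    rw [h_transform, h_symbol]
    positivity
  · obtain ⟨ξ, hξ, h_pos⟩ := exists_cosTransform_bumpAutocorrelation_pos (E := E)
    refine ⟨ξ, hξ, ?_⟩
    rw [h_transform, ← cosTransform_bumpAutocorrelation]
    exact mul_pos (hyperSymbol_pos hs hm hξ) h_pos

end Parametrix

section Reproduction

variable {E : Type*} [NormedAddCommGroup E] [NormedSpace ℝ E] [FiniteDimensional ℝ E]
  [Nontrivial E] [MeasureSpace E] [BorelSpace E] {r a : ℝ} {u : E → ℝ}

lemma integral_smul_l1Dilation_dilationAverage_eq {F : Type*} [NormedAddCommGroup F]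
    [NormedSpace ℝ F] {f : E → F} [SFinite (volume : Measure E)] (hr : 0 ≤ r)
    (hu : WeightIntegrable r u) (hf : SmoothDecay r f)
    (hρ : SmoothDecay r (dilationAverage (finrank ℝ E - 1) f)) (ha : 0 < a) {x : E}
    (h_zero : ∀ t, a ≤ t → ∫ y, u y • f (t • (x - y)) = 0) {b : ℝ} (hab : a ≤ b) :
    ∫ y, u y • l1Dilation b (dilationAverage (finrank ℝ E - 1) f) (x - y) =
      ∫ y, u y • l1Dilation a (dilationAverage (finrank ℝ E - 1) f) (x - y) := by
  rw [← sub_eq_zero, integral_smul_l1Dilation_dilationAverage_sub hr hu hf hρ ha hab,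
    ← intervalIntegral.integral_zero (a := a) (b := b)]
  refine intervalIntegral.integral_congr fun t ht => ?_
  rw [uIcc_of_le hab] at ht
  simp only [h_zero t ht.1, smul_zero]

variable [(volume : Measure E).IsAddHaarMeasure] {f : E → ℝ} {U : Set E}

lemma ae_integral_dilationAverage_mul_eq (hr : finrank ℝ E < r) (hu : WeightIntegrable r u)
    (hf : SmoothDecay r f) (hρ : SmoothDecay r (dilationAverage (finrank ℝ E - 1) f))
    (ha : 0 < a) (hU : IsOpen U)
    (h_zero : ∀ x ∈ U, ∀ t, a ≤ t → ∫ y, u y • f (t • (x - y)) = 0) :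
    ∀ᵐ x, x ∈ U → (∫ z, dilationAverage (finrank ℝ E - 1) f z) * u x =
      ∫ y, u y • l1Dilation a (dilationAverage (finrank ℝ E - 1) f) (x - y) := by
  have hr0 : 0 ≤ r := (Nat.cast_nonneg _).trans hr.le
  set ρ := dilationAverage (finrank ℝ E - 1) f
  have h_cont : Continuous fun x => ∫ y, u y • l1Dilation a ρ (x - y) :=
    ((hρ.l1Dilation hr0 ha).contDiff_integral_smul_sub hr0 hu).continuous
  have hu_loc : LocallyIntegrable fun x => (∫ z, ρ z) * u x := 
    hu.locallyIntegrable.smul (∫ z, ρ z)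
  have h_ae := hU.ae_eq_zero_of_integral_contDiff_smul_eq_zero
    ((hu_loc.sub h_cont.locallyIntegrable).locallyIntegrableOn U) fun g hg hgc hgU => ?_
  · filter_upwards [h_ae] with x hx hxU
    exact sub_eq_zero.1 (hx hxU)
  have h_eventually : ∀ᶠ t in atTop, ∫ x, g x • ∫ y, u y • l1Dilation t ρ (x - y) =
      ∫ x, g x • ∫ y, u y • l1Dilation a ρ (x - y) := by
    filter_upwards [eventually_ge_atTop a] with t ht
    congr 1 with x
    by_cases hx : x ∈ U
    · rw [integral_smul_l1Dilation_dilationAverage_eq hr0 hu hf hρ ha (h_zero x hx) ht]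
    · rw [image_eq_zero_of_notMem_tsupport fun h => hx (hgU h), zero_smul, zero_smul]
  have h_limit := tendsto_nhds_unique (tendsto_const_nhds.congr' (h_eventually.mono fun _ => .symm))
    (tendsto_integral_smul_integral_smul_l1Dilation_sub hr hg.continuous hgc hu hρ)
  have h_left := hu_loc.integrable_smul_left_of_hasCompactSupport hg.continuous hgc
  have h_right := (h_cont.locallyIntegrable (μ := volume)).integrable_smul_left_of_hasCompactSupport
    hg.continuous hgc
  simp only [Pi.sub_apply, smul_sub]
  rw [integral_sub h_left h_right, h_limit, sub_eq_zero]
  simp only [smul_eq_mul]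
  congr 1 with x
  ring

end Reproduction

section ReproducingKernel

variable {d : ℕ} [NeZero d] {s r : ℝ} {m : ℕ} {u : EuclideanSpace ℝ (Fin d) → ℝ}
  {Ω : Set (EuclideanSpace ℝ (Fin d))}

lemma integral_smul_hypersingular_bumpAutocorrelation_eq_zero (hs : 0 < s) (hm : s < m)
    (hu : IsFracHarmonicOn s u Ω) {t : ℝ} (ht : 0 < t) {x : EuclideanSpace ℝ (Fin d)}
    (hx : closedBall x t⁻¹ ⊆ Ω) :
    ∫ y, u y • hypersingular s m bumpAutocorrelation (t • (x - y)) = 0 := by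
  obtain ⟨κ, hκ, h_frac⟩ := exists_fracLaplacian_eq_hypersingular (d := d) hs hm
  set φ : EuclideanSpace ℝ (Fin d) → ℝ := fun y => bumpAutocorrelation (t • (x - y))
  have hφ : ContDiff ℝ ∞ φ := contDiff_bumpAutocorrelation.comp (by fun_prop)
  have h_supp : tsupport φ ⊆ closedBall x t⁻¹ := by
    refine closure_minimal (fun y hy => ?_) isClosed_closedBall
    contrapose! hy
    rw [mem_closedBall, not_le, dist_comm, dist_eq_norm, inv_lt_iff_one_lt_mul₀' ht] at hy
    refine Function.notMem_support.2 (bumpAutocorrelation_eq_zero ?_)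
    rw [norm_smul, Real.norm_of_nonneg ht.le]
    exact hy.le
  have hφc : HasCompactSupport φ :=
    (isCompact_closedBall x t⁻¹).of_isClosed_subset (isClosed_tsupport φ) h_supp
  have h_pairing := hu φ hφ hφc (h_supp.trans hx)
  simp only [h_frac φ hφ hφc, ← Complex.ofReal_mul] at h_pairing
  rw [integral_complex_ofReal, Complex.ofReal_eq_zero] at h_pairing
  simp only [φ, hypersingular_comp_smul_sub ht, smul_eq_mul, mul_left_comm (u _)] at h_pairing
  rw [integral_const_mul, integral_const_mul] at h_pairing
  simpa only [smul_eq_mul, mul_eq_zero, hκ.ne', (Real.rpow_pos_of_pos ht _).ne', false_or]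
    using h_pairing

lemma exists_reproducingKernel (hs : 0 < s) (hr : d < r) (hr' : r < d + 1) (hrs : r ≤ d + 2 * s) :
    ∃ K : EuclideanSpace ℝ (Fin d) → ℝ, SmoothDecay r K ∧
      ∀ (u : EuclideanSpace ℝ (Fin d) → ℝ) (Ω U : Set (EuclideanSpace ℝ (Fin d))) (t : ℝ),
        WeightIntegrable r u → IsFracHarmonicOn s u Ω → IsOpen U → 0 < t →
        (∀ x ∈ U, closedBall x t⁻¹ ⊆ Ω) →
        ∀ᵐ x, x ∈ U → u x = ∫ y, u y • l1Dilation t K (x - y) := by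
  have hm : s < (⌊s⌋₊ + 1 : ℕ) := by exact_mod_cast Nat.lt_floor_add_one s
  rw [← finrank_euclideanSpace_fin (𝕜 := ℝ) (n := d)] at hr hr' hrs
  have hρ := smoothDecay_parametrix (E := EuclideanSpace ℝ (Fin d)) hs hm hr hr' hrs
  have hc := integral_parametrix_pos (E := EuclideanSpace ℝ (Fin d)) hs hm hr hr' hrs
  have hr0 : 0 ≤ r := (Nat.cast_nonneg _).trans hr.le
  set ρ : EuclideanSpace ℝ (Fin d) → ℝ := parametrix s (⌊s⌋₊ + 1)
  set c := ∫ x, ρ x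
  have hK := hρ.const_smul_comp_smul hr0 c⁻¹ one_pos
  simp only [one_smul] at hK
  refine ⟨fun x => c⁻¹ • ρ x, hK, fun u Ω U t hu h_harm hU ht h_sub => ?_⟩
  have h_zero (x) (hx : x ∈ U) (τ : ℝ) (hτ : t ≤ τ) :
      ∫ y, u y • hypersingular s (⌊s⌋₊ + 1) bumpAutocorrelation (τ • (x - y)) = 0 := by
    refine integral_smul_hypersingular_bumpAutocorrelation_eq_zero hs hm h_harm (ht.trans_le hτ)
      ((closedBall_subset_closedBall ?_).trans (h_sub x hx))
    gcongr
  filter_upwards [ae_integral_dilationAverage_mul_eq hr hu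
    ((smoothDecay_hypersingular_bumpAutocorrelation hs hm).mono hrs) hρ ht hU h_zero] with x hx hxU
  simp only [l1Dilation, smul_comm _ c⁻¹]
  rw [integral_smul, smul_eq_mul, eq_inv_mul_iff_mul_eq₀ hc.ne']
  exact hx hxU

end ReproducingKernel

section DerivativeBounds

variable {E : Type*} [NormedAddCommGroup E] [NormedSpace ℝ E] [FiniteDimensional ℝ E]
  [MeasureSpace E] [BorelSpace E] [(volume : Measure E).IsAddHaarMeasure] {r : ℝ} {K : E → ℝ}

lemma SmoothDecay.exists_norm_iteratedFDeriv_integral_smul_l1Dilation_sub_le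
    (hK : SmoothDecay r K) (hr : finrank ℝ E < r) (n : ℕ) :
    ∃ C > 0, ∀ (p : ENNReal) (u : E → ℝ) (t : ℝ), 1 ≤ p → MemLp u p → 0 < t → ∀ x,
      ‖iteratedFDeriv ℝ n (fun x => ∫ y, u y • _root_.l1Dilation t K (x - y)) x‖ ≤
        C * t ^ (n + finrank ℝ E * p⁻¹.toReal) * (eLpNorm u p).toReal := by
  have hr0 : 0 ≤ r := (Nat.cast_nonneg _).trans hr.le
  obtain ⟨A, hA, h_bound⟩ := isBigO_top_polyWeight_iff.1 (hK.isBigO_iteratedFDeriv n)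
  refine ⟨A * max 1 (∫ x : E, polyWeight r x), by positivity, fun p u t hp hu ht x => ?_⟩
  rw [(hK.l1Dilation hr0 ht).iteratedFDeriv_integral_smul_sub hr0
    (WeightIntegrable.of_memLp hr hp hu)]
  have h_kernel (z : E) : ‖iteratedFDeriv ℝ n (_root_.l1Dilation t K) z‖ ≤
      A * t ^ n * t ^ finrank ℝ E * polyWeight r (t • z) := by
    have h_deriv := congrFun (iteratedFDeriv_const_smul_comp_smul (n := n)
      (hK.contDiff.of_le (mod_cast le_top)) (t ^ finrank ℝ E) t) z
    refine (congrArg norm h_deriv).trans_le ?_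
    rw [norm_smul, Real.norm_of_nonneg (by positivity)]
    calc _ ≤ t ^ finrank ℝ E * t ^ n * (A * polyWeight r (t • z)) := by gcongr; exact h_bound _
      _ = _ := by ring
  refine (norm_integral_smul_le_of_le_polyWeight hr hp hu (by positivity) ht h_kernel x).trans_eq ?_
  rw [Real.rpow_add ht, Real.rpow_natCast]
  ring

lemma SmoothDecay.exists_norm_iteratedFDeriv_integral_smul_l1Dilation_sub_le_sum
    (hK : SmoothDecay r K) (hr : finrank ℝ E < r) (n : ℕ) :
    ∃ C > 0, ∀ (k : ℕ) (p : Fin k → ENNReal) (w : Fin k → E → ℝ) (u : E → ℝ) (t : ℝ),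
      (∀ i, 1 ≤ p i) → (∀ i, MemLp (w i) (p i)) → (u =ᵐ[volume] fun y => ∑ i, w i y) → 0 < t →
      ∀ x, ‖iteratedFDeriv ℝ n (fun x => ∫ y, u y • _root_.l1Dilation t K (x - y)) x‖ ≤
        C * ∑ i, t ^ (n + finrank ℝ E * (p i)⁻¹.toReal) * (eLpNorm (w i) (p i)).toReal := by
  obtain ⟨C, hC, h_bound⟩ :=
    hK.exists_norm_iteratedFDeriv_integral_smul_l1Dilation_sub_le hr n
  refine ⟨C, hC, fun k p w u t hp hw hu ht x => ?_⟩
  have hr0 : 0 ≤ r := (Nat.cast_nonneg _).trans hr.le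
  have hKt := hK.l1Dilation hr0 ht
  have hw_int (i) : WeightIntegrable r (w i) := .of_memLp hr (hp i) (hw i)
  have h_smooth (i) := (hKt.contDiff_integral_smul_sub hr0 (hw_int i)).of_le
    (mod_cast le_top : (n : WithTop ℕ∞) ≤ ∞)
  simp only [integral_smul_comp_sub_eq_sum hr0 hw_int hu hKt.contDiff.continuous hKt.isBigO]
  rw [iteratedFDeriv_sum fun i _ => h_smooth i, Finset.sum_apply, Finset.mul_sum]
  refine norm_sum_le_of_le _ fun i _ => ?_
  rw [← mul_assoc]
  exact h_bound (p i) (w i) t (hp i) (hw i) ht x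

end DerivativeBounds

section MultiDeriv

variable {d : ℕ} {f : EuclideanSpace ℝ (Fin d) → ℝ}

lemma contDiff_partialDeriv (hf : ContDiff ℝ ∞ f) (i : Fin d) : ContDiff ℝ ∞ (partialDeriv i f) :=
  (hf.fderiv_right (m := ∞) le_rfl).clm_apply contDiff_const

lemma norm_iteratedFDeriv_partialDeriv_le (hf : ContDiff ℝ ∞ f) (i : Fin d) (N : ℕ)
    (x : EuclideanSpace ℝ (Fin d)) :
    ‖iteratedFDeriv ℝ N (partialDeriv i f) x‖ ≤ ‖iteratedFDeriv ℝ (N + 1) f x‖ := by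
  have h := norm_iteratedFDeriv_clm_apply_const (c := EuclideanSpace.single i (1 : ℝ))
    (hf.fderiv_right (m := ∞) le_rfl).contDiffAt (x := x) (n := N) (mod_cast le_top)
  rwa [PiLp.norm_single, norm_one, one_mul, norm_iteratedFDeriv_fderiv] at h

lemma iterate_partialDeriv_contDiff_and_norm_le (hf : ContDiff ℝ ∞ f) (i : Fin d) (k N : ℕ)
    (x : EuclideanSpace ℝ (Fin d)) : ContDiff ℝ ∞ ((partialDeriv i)^[k] f) ∧
      ‖iteratedFDeriv ℝ N ((partialDeriv i)^[k] f) x‖ ≤ ‖iteratedFDeriv ℝ (N + k) f x‖ := by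
  induction k generalizing N with
  | zero => exact ⟨hf, le_rfl⟩
  | succ k ih =>
    rw [Function.iterate_succ_apply']
    refine ⟨contDiff_partialDeriv (ih N).1 i,
      (norm_iteratedFDeriv_partialDeriv_le (ih N).1 i N x).trans ?_⟩
    rw [Nat.add_comm k 1, ← add_assoc]
    exact (ih (N + 1)).2

lemma foldr_partialDeriv_contDiff_and_norm_le (hf : ContDiff ℝ ∞ f) (n : Fin d → ℕ)
    (l : List (Fin d)) (N : ℕ) (x : EuclideanSpace ℝ (Fin d)) :
    ContDiff ℝ ∞ (l.foldr (fun i g => (partialDeriv i)^[n i] g) f) ∧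
      ‖iteratedFDeriv ℝ N (l.foldr (fun i g => (partialDeriv i)^[n i] g) f) x‖ ≤
        ‖iteratedFDeriv ℝ (N + (l.map n).sum) f x‖ := by
  induction l generalizing N with
  | nil => exact ⟨hf, le_rfl⟩
  | cons i l ih =>
    have h := iterate_partialDeriv_contDiff_and_norm_le (ih N).1 i (n i) N x
    refine ⟨h.1, h.2.trans ((ih (N + n i)).2.trans_eq ?_)⟩
    rw [List.map_cons, List.sum_cons, add_assoc]

lemma abs_multiDeriv_le (hf : ContDiff ℝ ∞ f) (n : Fin d → ℕ) (x : EuclideanSpace ℝ (Fin d)) :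
    |multiDeriv n f x| ≤ ‖iteratedFDeriv ℝ (∑ j, n j) f x‖ := by
  have h := (foldr_partialDeriv_contDiff_and_norm_le hf n (List.finRange d) 0 x).2
  rwa [norm_iteratedFDeriv_zero, zero_add, ← Fin.sum_univ_def] at h

end MultiDeriv

lemma closedBall_inv_two_div_subset_ball {E : Type*} [SeminormedAddCommGroup E] {R : ℝ} (x : E)
    (hx : x ∈ ball 0 (3 / 2 * R)) : closedBall x (2 / R)⁻¹ ⊆ ball 0 (2 * R) := by
  refine closedBall_subset_ball' ?_
  rw [mem_ball] at hx
  rw [inv_div]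
  linarith

lemma div_rpow_le_two_rpow_mul {R N d q : ℝ} (hR : 0 < R) (hd : 0 ≤ d) (hq : q ≤ 1) :
    (2 / R) ^ (N + d * q) ≤ 2 ^ (N + d) * R ^ (-N - d * q) := by
  rw [Real.div_rpow zero_le_two hR.le, div_eq_mul_inv, ← Real.rpow_neg hR.le, neg_add,
    ← sub_eq_add_neg]
  gcongr
  · exact one_le_two
  · exact mul_le_of_le_one_right hd hq

theorem corollary3p2_general (d : ℕ) [NeZero d] (s : ℝ) (hs : 0 < s) :
    ∃ C : (Fin d → ℕ) → ℝ, (∀ n, 0 < C n) ∧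
      ∀ (k : ℕ) (p : Fin k → ENNReal) (_hp : ∀ i, 1 ≤ p i)
        (w : Fin k → EuclideanSpace ℝ (Fin d) → ℝ) (_hw : ∀ i, MemLp (w i) (p i) volume)
        (u : EuclideanSpace ℝ (Fin d) → ℝ) (_hu : u =ᵐ[volume] fun x => ∑ i, w i x)
        (R : ℝ) (_hR : 0 < R) (_hharm : IsFracHarmonicOn s u (ball 0 (2 * R))),
        ∃ v : EuclideanSpace ℝ (Fin d) → ℝ,
          ContDiff ℝ ∞ v ∧ (∀ᵐ x ∂(volume.restrict (closedBall 0 R)), u x = v x) ∧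
          ∀ (n : Fin d → ℕ) (x : EuclideanSpace ℝ (Fin d)),
            |multiDeriv n v x| ≤
              C n * ∑ i, R ^ (-((∑ j, n j : ℕ) : ℝ) - d * (p i)⁻¹.toReal) *
                (eLpNorm (w i) (p i) volume).toReal := by
  set r : ℝ := d + min s (1 / 2)
  have hr : d < r := lt_add_of_pos_right _ (by positivity)
  have hr0 : 0 ≤ r := (Nat.cast_nonneg d).trans hr.le
  obtain ⟨K, hK, h_repro⟩ := exists_reproducingKernel hs hr
    (by linarith [min_le_right s (1 / 2)]) (by linarith [min_le_left s (1 / 2)])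
  rw [← finrank_euclideanSpace_fin (𝕜 := ℝ) (n := d)] at hr
  choose A hA h_deriv using hK.exists_norm_iteratedFDeriv_integral_smul_l1Dilation_sub_le_sum hr
  refine ⟨fun n => A (∑ j, n j) * 2 ^ ((∑ j, n j : ℕ) + d : ℝ),
    fun n => mul_pos (hA _) (by positivity), fun k p hp w hw u hu R hR h_harm => ?_⟩
  have ht : 0 < 2 / R := by positivity
  have hu_int : WeightIntegrable r u :=
    (WeightIntegrable.sum fun i _ => .of_memLp hr (hp i) (hw i)).congr hu
  have h_smooth := (hK.l1Dilation hr0 ht).contDiff_integral_smul_sub hr0 hu_int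
  refine ⟨_, h_smooth, ?_, fun n x => ?_⟩
  · have h_eq := h_repro u _ _ _ hu_int h_harm isOpen_ball ht
      (closedBall_inv_two_div_subset_ball (R := R))
    rw [ae_restrict_iff' measurableSet_closedBall]
    filter_upwards [h_eq] with x hx hxR
    exact hx (closedBall_subset_ball (by linarith) hxR)
  · refine (abs_multiDeriv_le h_smooth n x).trans ((h_deriv _ k p w u _ hp hw hu ht x).trans ?_)
    rw [finrank_euclideanSpace_fin, mul_assoc, Finset.mul_sum (a := 2 ^ _)]
    refine mul_le_mul_of_nonneg_left (Finset.sum_le_sum fun i _ => ?_) (hA _).le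
    rw [← mul_assoc]
    have hq : (p i)⁻¹.toReal ≤ 1 :=
      ENNReal.toReal_mono ENNReal.one_ne_top (ENNReal.inv_le_one.2 (hp i))
    exact mul_le_mul_of_nonneg_right (div_rpow_le_two_rpow_mul hR (Nat.cast_nonneg d) hq)
      ENNReal.toReal_nonneg

end

/-- `u ∈ C^∞(closure B_R)` means that `u` agrees a.e. on the ball with (the restriction of) a
`C^∞` function `v` on `ℝ^d`; the values of `D^n v` on the closed ball do not depend on the choice
of `v`, and `D^n u` there means `D^n v`. The constant `C n` depends only on `d`, `s` and `n`. -/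
theorem corollary3p2 (d : ℕ) (hd : 2 ≤ d) (s : ℝ) (hs0 : 0 < s) (hs : s < (d : ℝ) / 2) :
    ∃ C : (Fin d → ℕ) → ℝ, (∀ n, 0 < C n) ∧
      ∀ (k : ℕ) (p : Fin k → ℝ) (_hp : ∀ i, 1 ≤ p i)
        (w : Fin k → EuclideanSpace ℝ (Fin d) → ℝ)
        (_hw : ∀ i, MemLp (w i) (ENNReal.ofReal (p i)) volume)
        (u : EuclideanSpace ℝ (Fin d) → ℝ)
        (_hu : u =ᵐ[volume] fun x => ∑ i, w i x)
        (R : ℝ) (_hR : 0 < R)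
        (_hharm : IsFracHarmonicOn s u (Metric.ball 0 (2 * R))),
        ∃ v : EuclideanSpace ℝ (Fin d) → ℝ,
          ContDiff ℝ ∞ v ∧
          (∀ᵐ x ∂(volume.restrict (Metric.closedBall 0 R)), u x = v x) ∧
          ∀ (n : Fin d → ℕ), ∀ x ∈ Metric.closedBall (0 : EuclideanSpace ℝ (Fin d)) R,
            |multiDeriv n v x| ≤
              C n * ∑ i, R ^ (-((∑ j, n j : ℕ) : ℝ) - (d : ℝ) / p i) *
                (eLpNorm (w i) (ENNReal.ofReal (p i)) volume).toReal := by
  have : NeZero d := ⟨(two_pos.trans_le hd).ne'⟩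
  obtain ⟨C, hC, h_general⟩ := corollary3p2_general d s hs0
  refine ⟨C, hC, fun k p hp w hw u hu R hR h_harm => ?_⟩
  obtain ⟨v, hv, huv, h_bound⟩ := h_general k (fun i => ENNReal.ofReal (p i))
    (fun i => ENNReal.one_le_ofReal.2 (hp i)) w hw u hu R hR h_harm
  refine ⟨v, hv, huv, fun n x _ => ?_⟩
  simpa only [ENNReal.toReal_inv, ENNReal.toReal_ofReal (zero_le_one.trans (hp _)),
    ← div_eq_mul_inv] using h_bound n x
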